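/- **Setting.** For $l=1,2$ let $X_l\subset\mathbb{R}^{m_l}$ be nonempty, compact and convex, let $\|\cdot\|$ be a norm on $\mathbb{R}^{m_l}$ with dual norm $\|\cdot\|_*$, and let $O_l\supseteq X_l$ be open and convex. Network $l$ has $n_l\ge 1$ agents. Let $\xi$ be a random vector in $\mathbb{R}^d$. Agent $i$ of network 1 has the cost $f_{1,i}(x_1,x_2)=\mathbb{E}[\varphi_{1,i}(x_1,x_2;\xi)]$, which is defined on $O_1\times X_2$, convex in $x_1$ and concave in $x_2$; agent $j$ of network 2 has the cost $f_{2,j}(x_1,x_2)=\mathbb{E}[\varphi_{2,j}(x_1,x_2;\xi)]$, which is defined on $X_1\times O_2$, concave in $x_1$ and convex in $x_2$. Suppose that on $X_1\times X_2$ $$U=\frac1{n_1}\sum_{i}f_{1,i}=-\frac1{n_2}\sum_{j}f_{2,j},$$ and that, for some $\mu>0$, $U$ is $\mu$-strongly convex in $x_1\in X_1$ and $\mu$-strongly concave in $x_2\in X_2$. A Nash equilibrium (NE) is a point $(x_1^*,x_2^*)\in X_1\times X_2$ with $U(x_1^*,x_2)\le U(x_1^*,x_2^*)\le U(x_1,x_2^*)$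 for all $(x_1,x_2)\in X_1\times X_2$. **Networks.** Let $0<\eta<1$. For $l=1,2$ the digraphs $\mathcal{G}_l(t)$, $t\ge0$, on the agents of network $l$ contain all self-loops, and for some integer $B_l\ge1$ the union of any $B_l$ consecutive ones is strongly connected. The matrices $W_l(t)=[w_{l,ij}(t)]$ have all row and column sums equal to $1$, with $w_{l,ij}(t)\ge\eta$ if $(j,i)$ is an edge of $\mathcal{G}_l(t)$ and $w_{l,ij}(t)=0$ otherwise. Between the networks there are nonnegative weights $w_{12,ij}(t)$, where agent $i$ belongs to one network and $j$ runs over the agents of the other, positive only along the edges of a bipartite digraph, with $\sum_j w_{12,ij}(t)=1$ for every agent $i$. **Algorithm (D-SMD).** Let $\psi_l$ be differentiable at every point of $X_l$ and $1$-strongly convex on $X_l$, and let $D_{\psi_l}(x,p)=\psi_l(x)-\psi_l(p)-\langle\nabla\psi_l(p),x-p\rangle$. Assume that $R_l^2=\max\{D_{\psi_l}(x,x'):x,x'\in X_l\}$ exists. Let $\alpha(t)\ge0$ be non-increasing. Start from (possibly random) points $x_{l,i}(0)\in X_l$. At time $t$ agent $i$ of network $l$ forms $v_{l,i}(t)=\sum_j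 w_{l,ij}(t)x_{l,j}(t)$ and $u_{3-l,i}(t)=\sum_j w_{12,ij}(t)x_{3-l,j}(t)$. It then receives a sampled subgradient $\hat g_{l,i}(t)$ of $\varphi_{l,i}(\cdot\,;\xi_{l,i}(t))$ with respect to its own strategy in $O_l$, taken at $v_{l,i}(t)$ with the strategy of the other network fixed at $u_{3-l,i}(t)$, and sets $$x_{l,i}(t+1)=\operatorname*{arg\,min}_{x'\in X_l}\big\{\alpha(t)\langle\hat g_{l,i}(t),x'-v_{l,i}(t)\rangle+D_{\psi_l}(x',v_{l,i}(t))\big\}.$$ All the $\xi_{l,i}(t)$ are independent copies of $\xi$. Let $\mathcal{F}_t$ be the $\sigma$-algebra generated by the initial points and all the samples drawn before time $t$; $\hat g_{l,i}(t)$ is $\mathcal{F}_{t+1}$-measurable. **Assumptions.** (A1) There is $L>0$ such that $|f_{l,i}(x_1,x_2)-f_{l,i}(x_1',x_2')|\le L(\|x_1-x_1'\|+\|x_2-x_2'\|)$ on the domain of $f_{l,i}$, for all $l,i$. (A2) There are $\nu_1,\nu_2>0$ and, for all $l,i,t$, a subgradient $g_{l,i}(t)$ of $f_{l,i}$ with respect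 to the own strategy in $O_l$, at $v_{l,i}(t)$ with the other strategy fixed at $u_{3-l,i}(t)$, such that $\mathbb{E}[\hat g_{l,i}(t)\mid\mathcal{F}_t]=g_{l,i}(t)$ and $\mathbb{E}[\|g_{l,i}(t)-\hat g_{l,i}(t)\|_*^2\mid\mathcal{F}_t]\le\nu_l^2$. (A3) For $l=1,2$, $D_{\psi_l}(x,y)$ is convex in $y\in X_l$, and $x_k\to x$ in $X_l$ implies $D_{\psi_l}(x_k,x)\to0$. **Claim.** The game has exactly one NE $(x_1^*,x_2^*)$. Let $\hat x_{l,i}(t)=\sum_{s=0}^{t-1}\alpha(s)x_{l,i}(s)\big/\sum_{s=0}^{t-1}\alpha(s)$. Then for all agents $i$ of network 1 and $j$ of network 2 and all $t$ with $\sum_{s=0}^{t-1}\alpha(s)>0$, $$\mathbb{E}\big[\|\hat x_{1,i}(t)-x_1^*\|^2+\|\hat x_{2,j}(t)-x_2^*\|^2\big]\le\frac2\mu\cdot\frac{M_1+M_2\sum_{s=0}^{t-1}\alpha(s)^2}{\sum_{s=0}^{t-1}\alpha(s)},$$ where $$M_1=\sum_{l=1}^2\Big(\frac{4Ln_l\Gamma_l\Lambda_l\alpha(0)}{1-\theta_l}+2R_l^2\Big),\qquad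 M_2=\sum_{l=1}^2\Big(4L(L+\nu_l)\Big(\frac{n_l\Gamma_l}{1-\theta_l}+2\Big)+(L+\nu_l)^2+\frac{\nu_l^2}2\Big),$$ $\Gamma_l=(1-\eta/(4n_l^2))^{-2}$, $\theta_l=(1-\eta/(4n_l^2))^{1/B_l}$ and $\Lambda_l=\mathbb{E}[\max_i\|x_{l,i}(0)\|]$ (which is $\max_i\|x_{l,i}(0)\|$ for non-random initial points). In particular, if $\sum_{t}\alpha(t)=\infty$ and $\sum_t\alpha(t)^2<\infty$, then $(\hat x_{1,i}(t),\hat x_{2,j}(t))$ converges in mean square to the unique NE for all $i,j$. -/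

import Mathlib

open MeasureTheory ProbabilityTheory Filter Topology

namespace DSMD

/-- `(x₁, x₂)` is a Nash equilibrium of the zero-sum game in which player 1 minimizes `U` over
`X₁` and player 2 maximizes `U` over `X₂`. -/
def IsNash {E₁ E₂ : Type*} (X₁ : Set E₁) (X₂ : Set E₂) (U : E₁ → E₂ → ℝ)
    (x₁ : E₁) (x₂ : E₂) : Prop :=
  x₁ ∈ X₁ ∧ x₂ ∈ X₂ ∧ ∀ y₁ ∈ X₁, ∀ y₂ ∈ X₂, U x₁ y₂ ≤ U x₁ x₂ ∧ U x₁ x₂ ≤ U y₁ x₂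

/-- `U` is `μ`-strongly convex in `x₁ ∈ X₁` and `μ`-strongly concave in `x₂ ∈ X₂`. -/
def IsStronglyConvexConcave {E₁ E₂ : Type*}
    [NormedAddCommGroup E₁] [NormedSpace ℝ E₁] [NormedAddCommGroup E₂] [NormedSpace ℝ E₂]
    (X₁ : Set E₁) (X₂ : Set E₂) (μ : ℝ) (U : E₁ → E₂ → ℝ) : Prop :=
  (∀ x₂ ∈ X₂, StrongConvexOn X₁ μ (fun x₁ => U x₁ x₂)) ∧
    ∀ x₁ ∈ X₁, StrongConcaveOn X₂ μ (fun x₂ => U x₁ x₂)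

/-! ### Regularizers, Bregman divergence, prox-mapping -/

/-- The Bregman divergence `D_ψ(x, p) = ψ(x) - ψ(p) - ⟨∇ψ(p), x - p⟩`. -/
noncomputable def bregman {E : Type*} [NormedAddCommGroup E] [NormedSpace ℝ E]
    (ψ : E → ℝ) (x p : E) : ℝ :=
  ψ x - ψ p - fderiv ℝ ψ p (x - p)

/-- `ψ` is a `1`-strongly convex differentiable regularizer on `X`. -/
structure IsRegularizer {E : Type*} [NormedAddCommGroup E] [NormedSpace ℝ E]
    (X : Set E) (ψ : E → ℝ) : Prop where
  strongConvex : StrongConvexOn X 1 ψ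
  differentiable : ∀ x ∈ X, DifferentiableAt ℝ ψ x

/-- `p = P_x(y)`, that is, `p` minimizes `x' ↦ ⟨y, x - x'⟩ + D_ψ(x', x)` over `X`. -/
def IsProx {E : Type*} [NormedAddCommGroup E] [NormedSpace ℝ E]
    (X : Set E) (ψ : E → ℝ) (x : E) (y : StrongDual ℝ E) (p : E) : Prop :=
  p ∈ X ∧ ∀ x' ∈ X, y (x - p) + bregman ψ p x ≤ y (x - x') + bregman ψ x' x

/-- `D_ψ(x, y)` is convex in `y`, and `x_k → x` implies `D_ψ(x_k, x) → 0`. -/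
structure BregmanAssumption {E : Type*} [NormedAddCommGroup E] [NormedSpace ℝ E]
    (X : Set E) (ψ : E → ℝ) : Prop where
  convex_right : ∀ x ∈ X, ConvexOn ℝ X (fun y => bregman ψ x y)
  reciprocity : ∀ (z : ℕ → E) (x : E), (∀ k, z k ∈ X) → x ∈ X → Tendsto z atTop (𝓝 x) →
    Tendsto (fun k => bregman ψ (z k) x) atTop (𝓝 0)

/-- `R² = max {D_ψ(x, x') : x, x' ∈ X}`. -/
def IsBregmanDiam {E : Type*} [NormedAddCommGroup E] [NormedSpace ℝ E]
    (X : Set E) (ψ : E → ℝ) (R : ℝ) : Prop :=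
  IsGreatest {r : ℝ | ∃ x ∈ X, ∃ x' ∈ X, r = bregman ψ x x'} (R ^ 2)

/-! ### Networks -/

/-- The weights `W(t)` of one network over the digraphs `G(t)`. An edge from `j` to `i` means that
`i` receives the estimate of `j`. Every agent also keeps a share of its own estimate
(`self_loop`), and the graphs are jointly strongly connected over any `B` consecutive times. -/
structure IsMixing {n : ℕ} (G : ℕ → Digraph (Fin n)) (W : ℕ → Matrix (Fin n) (Fin n) ℝ)
    (η : ℝ) (B : ℕ) : Prop where
  self_loop : ∀ t i, (G t).Adj i i
  weight_of_edge : ∀ t i j, (G t).Adj j i → η ≤ W t i j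
  weight_of_not_edge : ∀ t i j, ¬ (G t).Adj j i → W t i j = 0
  row_sum : ∀ t i, ∑ j, W t i j = 1
  col_sum : ∀ t j, ∑ i, W t i j = 1
  one_le_window : 1 ≤ B
  connected : ∀ k i j,
    Relation.ReflTransGen (fun a b => ∃ t, k ≤ t ∧ t < k + B ∧ (G t).Adj a b) i j

/-- The weights between the two networks over the bipartite digraphs `G(t)`: each agent forms a
weighted average of the estimates of the agents of the other network. -/
structure IsCrossMixing {n₁ n₂ : ℕ} (G : ℕ → Digraph (Fin n₁ ⊕ Fin n₂))
    (W : ℕ → Matrix (Fin n₁ ⊕ Fin n₂) (Fin n₁ ⊕ Fin n₂) ℝ) : Prop where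
  bipartite₁ : ∀ t (i j : Fin n₁), ¬ (G t).Adj (Sum.inl i) (Sum.inl j)
  bipartite₂ : ∀ t (i j : Fin n₂), ¬ (G t).Adj (Sum.inr i) (Sum.inr j)
  nonneg : ∀ t i j, 0 ≤ W t i j
  edge_of_pos : ∀ t i j, 0 < W t i j → (G t).Adj j i
  row_sum₁ : ∀ t (i : Fin n₁), ∑ j : Fin n₂, W t (Sum.inl i) (Sum.inr j) = 1
  row_sum₂ : ∀ t (i : Fin n₂), ∑ j : Fin n₁, W t (Sum.inr i) (Sum.inl j) = 1

/-- `∑ⱼ wⱼ xⱼ(t)`, the average with weights `w` of the estimates at time `t`. -/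
def mix {Ω E : Type*} [NormedAddCommGroup E] [NormedSpace ℝ E] {n : ℕ}
    (w : Fin n → ℝ) (x : Fin n → ℕ → Ω → E) (t : ℕ) (ω : Ω) : E :=
  ∑ j, w j • x j t ω

/-! ### Costs -/

/-- The expected cost `f(x, y) = 𝔼[φ(x, y; ξ)]`. -/
noncomputable def expCost {Ω Z E F : Type*} [MeasurableSpace Ω] (P : Measure Ω) (ξ : Ω → Z)
    (φ : E → F → Z → ℝ) (x : E) (y : F) : ℝ :=
  ∫ ω, φ x y (ξ ω) ∂P

/-- `f` is convex-concave on `O × Y`. -/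
structure IsConvexConcave {E F : Type*} [NormedAddCommGroup E] [NormedSpace ℝ E]
    [NormedAddCommGroup F] [NormedSpace ℝ F] (O : Set E) (Y : Set F) (f : E → F → ℝ) : Prop where
  convex : ∀ y ∈ Y, ConvexOn ℝ O (fun x => f x y)
  concave : ∀ x ∈ O, ConcaveOn ℝ Y (fun y => f x y)

/-- `|f(x, y) - f(x', y')| ≤ L (‖x - x'‖ + ‖y - y'‖)` on `O × Y`. -/
def IsLipschitzCost {E F : Type*} [NormedAddCommGroup E] [NormedAddCommGroup F]
    (O : Set E) (Y : Set F) (L : ℝ) (f : E → F → ℝ) : Prop :=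
  ∀ x ∈ O, ∀ x' ∈ O, ∀ y ∈ Y, ∀ y' ∈ Y, |f x y - f x' y'| ≤ L * (‖x - x'‖ + ‖y - y'‖)

/-- The subdifferential at `x` of a function `h` with domain `O`. -/
def subdiff {E : Type*} [NormedAddCommGroup E] [NormedSpace ℝ E]
    (O : Set E) (h : E → ℝ) (x : E) : Set (StrongDual ℝ E) :=
  {g | ∀ y ∈ O, h x + g (y - x) ≤ h y}

/-! ### The algorithm -/

/-- The `σ`-algebra `ℱ_t` generated by the initial estimates and the samples drawn before `t`. -/
@[reducible] def history {Ω Z E₁ E₂ : Type*} [MeasurableSpace Z] [MeasurableSpace E₁] [MeasurableSpace E₂]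
    {n₁ n₂ : ℕ} (x₁ : Fin n₁ → ℕ → Ω → E₁) (x₂ : Fin n₂ → ℕ → Ω → E₂)
    (ξ₁ : Fin n₁ → ℕ → Ω → Z) (ξ₂ : Fin n₂ → ℕ → Ω → Z) (t : ℕ) : MeasurableSpace Ω :=
  ((⨆ i, MeasurableSpace.comap (x₁ i 0) inferInstance) ⊔
    (⨆ i, MeasurableSpace.comap (x₂ i 0) inferInstance)) ⊔
  ((⨆ i, ⨆ s, ⨆ (_ : s < t), MeasurableSpace.comap (ξ₁ i s) inferInstance) ⊔
    (⨆ i, ⨆ s, ⨆ (_ : s < t), MeasurableSpace.comap (ξ₂ i s) inferInstance))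

/-- The samples `ξ_{l,i}(t)` are independent copies of `ξ`. -/
structure IsIIDSample {Ω Z : Type*} [MeasurableSpace Ω] [MeasurableSpace Z] (P : Measure Ω)
    {n₁ n₂ : ℕ} (ξ : Ω → Z) (ξ₁ : Fin n₁ → ℕ → Ω → Z) (ξ₂ : Fin n₂ → ℕ → Ω → Z) : Prop where
  measurable : Measurable ξ
  measurable₁ : ∀ i t, Measurable (ξ₁ i t)
  measurable₂ : ∀ j t, Measurable (ξ₂ j t)
  identDistrib₁ : ∀ i t, IdentDistrib (ξ₁ i t) ξ P P
  identDistrib₂ : ∀ j t, IdentDistrib (ξ₂ j t) ξ P P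
  indep : iIndepFun (fun (p : (Fin n₁ ⊕ Fin n₂) × ℕ) =>
    Sum.elim (fun i => ξ₁ i p.2) (fun j => ξ₂ j p.2) p.1) P

/-- The updates of the agents of one network. `E` is the space of the network, `F` that of the
other one; `v i t` and `u i t` are the averages that agent `i` forms at time `t` inside its own
network and over the other network, `ghat i t` is its sampled subgradient, `φ i` its sampled cost
with its own strategy as the first argument. -/
structure IsRun {Ω Z E F : Type*} [MeasurableSpace Ω] [NormedAddCommGroup E] [NormedSpace ℝ E]
    [MeasurableSpace E] {n : ℕ}
    (X O : Set E) (ψ : E → ℝ) (α : ℕ → ℝ) (φ : Fin n → E → F → Z → ℝ)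
    (ℱ : ℕ → MeasurableSpace Ω) (ξ : Fin n → ℕ → Ω → Z) (v : Fin n → ℕ → Ω → E)
    (u : Fin n → ℕ → Ω → F) (ghat : Fin n → ℕ → Ω → StrongDual ℝ E)
    (x : Fin n → ℕ → Ω → E) : Prop where
  init_mem : ∀ i ω, x i 0 ω ∈ X
  init_measurable : ∀ i, Measurable (x i 0)
  sampled : ∀ i t ω, ghat i t ω ∈ subdiff O (fun y => φ i y (u i t ω) (ξ i t ω)) (v i t ω)
  sampled_measurable : ∀ i t, StronglyMeasurable[ℱ (t + 1)] (ghat i t)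
  update : ∀ i t ω, IsProx X ψ (v i t ω) (-(α t • ghat i t ω)) (x i (t + 1) ω)

/-- `g i t` is a subgradient of the expected cost at the averages formed by agent `i`, the sampled
subgradient is conditionally unbiased, `𝔼[ghat | ℱ_t] = g`, and has conditional variance
`𝔼[‖g - ghat‖_*² | ℱ_t] ≤ ν²`. -/
structure UnbiasedSampling {Ω E F : Type*} [MeasurableSpace Ω] (P : Measure Ω)
    [NormedAddCommGroup E] [NormedSpace ℝ E] {n : ℕ}
    (O : Set E) (f : Fin n → E → F → ℝ) (ν : ℝ) (ℱ : ℕ → MeasurableSpace Ω)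
    (v : Fin n → ℕ → Ω → E) (u : Fin n → ℕ → Ω → F)
    (g ghat : Fin n → ℕ → Ω → StrongDual ℝ E) : Prop where
  subgradient : ∀ i t, ∀ᵐ ω ∂P, g i t ω ∈ subdiff O (fun y => f i y (u i t ω)) (v i t ω)
  integrable : ∀ i t, Integrable (ghat i t) P
  unbiased : ∀ i t, P[ghat i t | ℱ t] =ᵐ[P] g i t
  sq_integrable : ∀ i t, Integrable (fun ω => ‖g i t ω - ghat i t ω‖ ^ 2) P
  variance_le : ∀ i t,
    P[fun ω => ‖g i t ω - ghat i t ω‖ ^ 2 | ℱ t] ≤ᵐ[P] fun _ => ν ^ 2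

/-- The weighted time average `(∑_{s<t} α(s))⁻¹ ∑_{s<t} α(s) x(s)`. -/
noncomputable def timeAvg {Ω E : Type*} [NormedAddCommGroup E] [NormedSpace ℝ E]
    (α : ℕ → ℝ) (x : ℕ → Ω → E) (t : ℕ) (ω : Ω) : E :=
  (∑ s ∈ Finset.range t, α s)⁻¹ • ∑ s ∈ Finset.range t, α s • x s ω

/-- `‖x̂_{1}(t) - x₁*‖² + ‖x̂_{2}(t) - x₂*‖²`. -/
noncomputable def sqError {Ω E₁ E₂ : Type*} [NormedAddCommGroup E₁] [NormedSpace ℝ E₁]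
    [NormedAddCommGroup E₂] [NormedSpace ℝ E₂] (α : ℕ → ℝ) (x₁ : ℕ → Ω → E₁) (x₂ : ℕ → Ω → E₂)
    (y₁ : E₁) (y₂ : E₂) (t : ℕ) (ω : Ω) : ℝ :=
  ‖timeAvg α x₁ t ω - y₁‖ ^ 2 + ‖timeAvg α x₂ t ω - y₂‖ ^ 2

/-! ### Constants -/

/-- `Γ = (1 - η / (4 n²))⁻²`. -/
noncomputable def Gam (η : ℝ) (n : ℕ) : ℝ := ((1 - η / (4 * (n : ℝ) ^ 2)) ^ 2)⁻¹

/-- `θ = (1 - η / (4 n²))^(1/B)`. -/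
noncomputable def theta (η : ℝ) (n B : ℕ) : ℝ := (1 - η / (4 * (n : ℝ) ^ 2)) ^ (1 / (B : ℝ))

/-- `Λ = 𝔼[maxᵢ ‖xᵢ(0)‖]`, which is `maxᵢ ‖xᵢ(0)‖` when the initial estimates are not random. -/
noncomputable def Lam {Ω E : Type*} [MeasurableSpace Ω] (P : Measure Ω) [NormedAddCommGroup E]
    {n : ℕ} (x : Fin n → ℕ → Ω → E) : ℝ :=
  ∫ ω, ⨆ i, ‖x i 0 ω‖ ∂P

/-- The contribution `4 L n Γ Λ α(0) / (1 - θ) + 2 R²` of one network to `M₁`. -/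
noncomputable def M1part (L η : ℝ) (n B : ℕ) (Λ α0 R : ℝ) : ℝ :=
  4 * L * n * Gam η n * Λ * α0 / (1 - theta η n B) + 2 * R ^ 2

/-- The contribution `4 L (L + ν) (n Γ / (1 - θ) + 2) + (L + ν)² + ν² / 2` of one network to
`M₂`. -/
noncomputable def M2part (L ν η : ℝ) (n B : ℕ) : ℝ :=
  4 * L * (L + ν) * (n * Gam η n / (1 - theta η n B) + 2) + (L + ν) ^ 2 + ν ^ 2 / 2

end DSMD

/-!
By the mirror-descent inequality each network has small regret against any fixed strategy for
its linearized costs: the Bregman divergences to that strategy telescope, averaging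
over neighbours does not increase their mean because the mixing matrices are doubly stochastic and
`D_ψ(z, ·)` is convex, and the sampling noise has mean zero because the `v_i(t)` are
`ℱ_t`-measurable. Convexity in the own strategy and the Lipschitz condition turn linearized regret
at the `v_i(t)` into the saddle gap of `U` at the averages of the estimates, at the price of the
distances of the estimates to those averages. At a Nash equilibrium strong convexity–concavity makes
the gap at least `μ / 2` times the squared distance; averaging in time with weights `α`, by
convexity of the square, gives the bound.

The distances are controlled by the geometric convergence of `W(t) ⋯ W(0)` to the averaging matrix.
For a vector `z` with ranked values, a doubly stochastic matrix lowers `∑ k, (z k - mean)²` by at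
least a multiple of the squared gaps between consecutive values that some edge crosses. Over a
window of `B` steps strong connectivity makes every cut be crossed, and the first crossing of a cut
sees the two sides still unmixed, so a fixed fraction of the variance is lost.
-/

namespace DSMD

/-! ### Contraction of the disagreement under doubly stochastic matrices -/

section Cuts

variable {ι : Type*}

/-- The cut of the ranking `r` between the ranks `d` and `d + 1` separates the values `x`: those
ranked up to `d` are at most `y d`, the others at least `y (d + 1)`. -/
def IsSeparated (y : ℕ → ℝ) (r : ι → ℕ) (d : ℕ) (x : ι → ℝ) : Prop :=
  ∀ i, (r i ≤ d → x i ≤ y d) ∧ (d < r i → y (d + 1) ≤ x i)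

variable {y : ℕ → ℝ} (hy : Monotone y) {r : ι → ℕ} {D : Finset ℕ} {x : ι → ℝ}
  (hx : ∀ d ∈ D, IsSeparated y r d x)

include hy hx in
theorem sum_sq_gap_le_sq_sub (i j : ι) :
    ∑ d ∈ D with ¬ (r i ≤ d ↔ r j ≤ d), (y (d + 1) - y d) ^ 2 ≤ (x i - x j) ^ 2 := by
  wlog hij : r i ≤ r j generalizing i j
  · simpa only [iff_comm, sub_sq_comm] using this j i (le_of_not_ge hij)
  set C := D.filter fun d => ¬ (r i ≤ d ↔ r j ≤ d)
  have hC : ∀ d ∈ C, d ∈ D ∧ r i ≤ d ∧ d < r j := fun d hd => by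
    obtain ⟨hdD, hd⟩ := Finset.mem_filter.1 hd
    exact ⟨hdD, by omega, by omega⟩
  have hgap : ∀ d, 0 ≤ y (d + 1) - y d := fun d => sub_nonneg.2 (hy d.le_succ)
  rcases C.eq_empty_or_nonempty with hne | hne
  · simpa [hne] using sq_nonneg (x i - x j)
  obtain ⟨haD, hia, -⟩ := hC _ (C.min'_mem hne)
  obtain ⟨hbD, -, hbj⟩ := hC _ (C.max'_mem hne)
  have hab : C.min' hne ≤ C.max' hne + 1 := (C.min'_le_max' hne).trans (Nat.le_succ _)
  have hCIco : C ⊆ Finset.Ico (C.min' hne) (C.max' hne + 1) := fun d hd =>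
    Finset.mem_Ico.2 ⟨C.min'_le d hd, Nat.lt_succ_of_le (C.le_max' d hd)⟩
  have htotal : ∑ d ∈ C, (y (d + 1) - y d) ≤ x j - x i :=
    calc ∑ d ∈ C, (y (d + 1) - y d)
        ≤ ∑ d ∈ Finset.Ico (C.min' hne) (C.max' hne + 1), (y (d + 1) - y d) :=
          Finset.sum_le_sum_of_subset_of_nonneg hCIco fun d _ _ => hgap d
      _ = y (C.max' hne + 1) - y (C.min' hne) := Finset.sum_Ico_sub y hab
      _ ≤ x j - x i := sub_le_sub ((hx _ hbD j).2 hbj) ((hx _ haD i).1 hia)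
  calc ∑ d ∈ C, (y (d + 1) - y d) ^ 2 ≤ (∑ d ∈ C, (y (d + 1) - y d)) ^ 2 :=
        Finset.sum_sq_le_sq_sum_of_nonneg fun d _ => hgap d
    _ ≤ (x j - x i) ^ 2 := pow_le_pow_left₀ (Finset.sum_nonneg fun d _ => hgap d) htotal 2
    _ = (x i - x j) ^ 2 := sub_sq_comm _ _

variable [Fintype ι]

theorem sum_mul_sq_sub_sq_sum (a x : ι → ℝ) (ha : ∑ i, a i = 1) :
    ∑ i, a i * x i ^ 2 - (∑ i, a i * x i) ^ 2
      = 1 / 2 * ∑ i, ∑ j, a i * a j * (x i - x j) ^ 2 := by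
  have expand : ∀ i j, a i * a j * (x i - x j) ^ 2
      = (a i * x i ^ 2) * a j - 2 * ((a i * x i) * (a j * x j)) + a i * (a j * x j ^ 2) :=
    fun i j => by ring
  simp only [expand, Finset.sum_add_distrib, Finset.sum_sub_distrib, ← Finset.mul_sum,
    ← Finset.sum_mul, ha]
  ring

theorem sum_sum_not_iff_mul (a : ι → ℝ) (p : ι → Prop) [DecidablePred p] :
    ∑ i, ∑ j with ¬ (p i ↔ p j), a i * a j
      = 2 * ((∑ i with p i, a i) * ∑ i with ¬ p i, a i) := by
  have inner : ∀ i, ∑ j with ¬ (p i ↔ p j), a i * a j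
      = (if p i then a i * ∑ j with ¬ p j, a j else 0)
        + if ¬ p i then a i * ∑ j with p j, a j else 0 := fun i => by
    by_cases hi : p i <;> simp [hi, Finset.mul_sum]
  simp only [inner, Finset.sum_add_distrib, ← Finset.sum_filter, ← Finset.sum_mul]
  ring

include hy hx in
theorem sum_sq_gap_mul_le {a : ι → ℝ} (ha₀ : ∀ i, 0 ≤ a i) (ha : ∑ i, a i = 1) :
    ∑ d ∈ D, (y (d + 1) - y d) ^ 2 *
        ((∑ i with r i ≤ d, a i) * ∑ i with ¬ r i ≤ d, a i)
      ≤ ∑ i, a i * x i ^ 2 - (∑ i, a i * x i) ^ 2 := by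
  have swap : ∑ d ∈ D, (y (d + 1) - y d) ^ 2 *
        ∑ i, ∑ j with ¬ (r i ≤ d ↔ r j ≤ d), a i * a j
      = ∑ i, ∑ j, a i * a j *
        ∑ d ∈ D with ¬ (r i ≤ d ↔ r j ≤ d), (y (d + 1) - y d) ^ 2 := by
    simp only [Finset.sum_filter, Finset.mul_sum]
    rw [Finset.sum_comm]
    refine Finset.sum_congr rfl fun i _ => ?_
    rw [Finset.sum_comm]
    simp only [mul_ite, mul_zero, mul_comm]
  calc ∑ d ∈ D, (y (d + 1) - y d) ^ 2 *
        ((∑ i with r i ≤ d, a i) * ∑ i with ¬ r i ≤ d, a i)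
      = 1 / 2 * ∑ d ∈ D, (y (d + 1) - y d) ^ 2 *
          ∑ i, ∑ j with ¬ (r i ≤ d ↔ r j ≤ d), a i * a j := by
        rw [Finset.mul_sum]
        exact Finset.sum_congr rfl fun d _ => by rw [sum_sum_not_iff_mul]; ring
    _ = 1 / 2 * ∑ i, ∑ j, a i * a j *
          ∑ d ∈ D with ¬ (r i ≤ d ↔ r j ≤ d), (y (d + 1) - y d) ^ 2 := by rw [swap]
    _ ≤ 1 / 2 * ∑ i, ∑ j, a i * a j * (x i - x j) ^ 2 := by
        gcongr with i _ j _
        · exact mul_nonneg (ha₀ i) (ha₀ j)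
        · exact sum_sq_gap_le_sq_sub hy hx i j
    _ = _ := (sum_mul_sq_sub_sq_sum a x ha).symm

end Cuts

section Average

variable {n : ℕ} {E : Type*} [NormedAddCommGroup E] [NormedSpace ℝ E]

/-- The average `(1 / n) ∑ⱼ xⱼ` of the estimates of the agents. -/
noncomputable def avg (x : Fin n → E) : E := (1 / (n : ℝ)) • ∑ j, x j

theorem avg_mem {X : Set E} (hX : Convex ℝ X) (hn : 0 < n) {x : Fin n → E} (hx : ∀ j, x j ∈ X) :
    avg x ∈ X := by
  rw [avg, Finset.smul_sum]
  refine hX.sum_mem (fun _ _ => by positivity) ?_ fun j _ => hx j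
  simp [Nat.cast_ne_zero.2 hn.ne']

end Average

/-- The total squared deviation `∑ᵢ (xᵢ - x̄)²` from the average, the Lyapunov function of the
averaging iteration. -/
noncomputable def sqDeviation {n : ℕ} (x : Fin n → ℝ) : ℝ := ∑ i, (x i - avg x) ^ 2

theorem sqDeviation_nonneg {n : ℕ} (x : Fin n → ℝ) : 0 ≤ sqDeviation x :=
  Finset.sum_nonneg fun _ _ => sq_nonneg _

theorem sqDeviation_eq {n : ℕ} (x : Fin n → ℝ) :
    sqDeviation x = ∑ i, x i ^ 2 - (∑ j, x j) ^ 2 / n := by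
  rcases n.eq_zero_or_pos with rfl | hn
  · simp [sqDeviation]
  simp only [sqDeviation, avg, smul_eq_mul, sub_sq, Finset.sum_add_distrib, Finset.sum_sub_distrib,
    ← Finset.sum_mul, ← Finset.mul_sum, Finset.sum_const, Finset.card_univ, Fintype.card_fin,
    nsmul_eq_mul]
  field_simp
  ring

theorem exists_monotone_ranking {n : ℕ} (x : Fin n → ℝ) :
    ∃ (y : ℕ → ℝ) (r : Fin n ≃ Fin n), Monotone y ∧ ∀ i, x i = y (r i) := by
  rcases n.eq_zero_or_pos with rfl | hn
  · exact ⟨0, Equiv.refl _, monotone_const, fun i => i.elim0⟩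
  refine ⟨fun d => x (Tuple.sort x ⟨min d (n - 1), by omega⟩), (Tuple.sort x).symm,
    fun a b hab => Tuple.monotone_sort x (Fin.mk_le_mk.2 (min_le_min_right _ hab)), fun i => ?_⟩
  have hmin : min ((Tuple.sort x).symm i : ℕ) (n - 1) = (Tuple.sort x).symm i := by omega
  simp only [hmin, Fin.eta, Equiv.apply_symm_apply]

theorem isSeparated_of_eq_ranking {n : ℕ} {y : ℕ → ℝ} (hy : Monotone y) {r : Fin n → ℕ}
    {x : Fin n → ℝ} (hx : ∀ i, x i = y (r i)) (d : ℕ) : IsSeparated y r d x := fun i => by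
  rw [hx i]
  exact ⟨fun hi => hy hi, fun hi => hy hi⟩

theorem sqDeviation_le_sum_sq_gap {n : ℕ} {y : ℕ → ℝ} (hy : Monotone y) {r : Fin n → Fin n}
    {x : Fin n → ℝ} (hx : ∀ i, x i = y (r i)) :
    sqDeviation x ≤ (n : ℝ) ^ 2 * ∑ d ∈ Finset.range (n - 1), (y (d + 1) - y d) ^ 2 := by
  rcases n.eq_zero_or_pos with rfl | hn
  · simp [sqDeviation]
  set spread := y (n - 1) - y 0
  have hmem : ∀ i, x i ∈ Set.Icc (y 0) (y (n - 1)) := fun i => by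
    rw [hx i]
    exact ⟨hy (Nat.zero_le _), hy (by omega)⟩
  have havg : avg x ∈ Set.Icc (y 0) (y (n - 1)) := avg_mem (convex_Icc _ _) hn hmem
  have hdev : ∀ i, (x i - avg x) ^ 2 ≤ spread ^ 2 := fun i =>
    sq_le_sq' (by linarith [(hmem i).1, havg.2]) (by linarith [(hmem i).2, havg.1])
  calc sqDeviation x ≤ ∑ _i : Fin n, spread ^ 2 := Finset.sum_le_sum fun i _ => hdev i
    _ = n * (∑ d ∈ Finset.range (n - 1), (y (d + 1) - y d)) ^ 2 := by
        rw [Finset.sum_range_sub]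
        simp [spread]
    _ ≤ n * (n * ∑ d ∈ Finset.range (n - 1), (y (d + 1) - y d) ^ 2) := by
        gcongr
        refine sq_sum_le_card_mul_sum_sq.trans ?_
        rw [Finset.card_range]
        gcongr
        exact Nat.sub_le _ _
    _ = _ := by ring

section Mixing

variable {n : ℕ} {G : ℕ → Digraph (Fin n)} {W : ℕ → Matrix (Fin n) (Fin n) ℝ} {η : ℝ} {B : ℕ}

theorem IsMixing.shift (h : IsMixing G W η B) (s : ℕ) :
    IsMixing (fun t => G (s + t)) (fun t => W (s + t)) η B where
  self_loop t := h.self_loop _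
  weight_of_edge t := h.weight_of_edge _
  weight_of_not_edge t := h.weight_of_not_edge _
  row_sum t := h.row_sum _
  col_sum t := h.col_sum _
  one_le_window := h.one_le_window
  connected k i j := by
    refine Relation.ReflTransGen.mono ?_ i j (h.connected (s + k) i j)
    rintro a b ⟨t, hkt, htk, hab⟩
    exact ⟨t - s, by omega, by omega, by rwa [Nat.add_sub_cancel' (by omega)]⟩

theorem IsMixing.sum_mulVec (h : IsMixing G W η B) (t : ℕ) (x : Fin n → ℝ) :
    ∑ i, (W t).mulVec x i = ∑ i, x i := by
  simp only [Matrix.mulVec, dotProduct]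
  rw [Finset.sum_comm]
  simp only [← Finset.sum_mul, h.col_sum, one_mul]

theorem IsMixing.nonneg (h : IsMixing G W η B) (hη : 0 < η) (t : ℕ) (i j : Fin n) :
    0 ≤ W t i j := by
  by_cases hji : (G t).Adj j i
  · exact hη.le.trans (h.weight_of_edge t i j hji)
  · exact (h.weight_of_not_edge t i j hji).ge

theorem IsMixing.mulVec_le (h : IsMixing G W η B) (hη : 0 < η) {t : ℕ} {i : Fin n} {x : Fin n → ℝ}
    {c : ℝ} (hx : ∀ j, (G t).Adj j i → x j ≤ c) : (W t).mulVec x i ≤ c := by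
  calc (W t).mulVec x i = ∑ j, W t i j * x j := rfl
    _ ≤ ∑ j, W t i j * c := Finset.sum_le_sum fun j _ => by
        by_cases hji : (G t).Adj j i
        · exact mul_le_mul_of_nonneg_left (hx j hji) (h.nonneg hη t i j)
        · simp [h.weight_of_not_edge t i j hji]
    _ = c := by rw [← Finset.sum_mul, h.row_sum, one_mul]

theorem IsMixing.le_mulVec (h : IsMixing G W η B) (hη : 0 < η) {t : ℕ} {i : Fin n} {x : Fin n → ℝ}
    {c : ℝ} (hx : ∀ j, (G t).Adj j i → c ≤ x j) : c ≤ (W t).mulVec x i := by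
  have hneg := h.mulVec_le hη (x := -x) (c := -c) fun j hji => neg_le_neg (hx j hji)
  rw [Matrix.mulVec_neg] at hneg
  exact neg_le_neg_iff.1 hneg

theorem IsMixing.isSeparated_mulVec (h : IsMixing G W η B) (hη : 0 < η) {t : ℕ} {y : ℕ → ℝ}
    {r : Fin n → ℕ} {d : ℕ} {x : Fin n → ℝ} (hx : IsSeparated y r d x)
    (hG : ∀ a b, (G t).Adj a b → (r a ≤ d ↔ r b ≤ d)) : IsSeparated y r d ((W t).mulVec x) :=
  fun i => ⟨fun hi => h.mulVec_le hη fun j hji => (hx j).1 ((hG j i hji).2 hi),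
    fun hi => h.le_mulVec hη fun j hji => (hx j).2 (not_le.1 fun hj =>
      not_le.2 hi ((hG j i hji).1 hj))⟩

theorem IsMixing.sum_sq_sub_sum_sq_mulVec (h : IsMixing G W η B) (t : ℕ) (x : Fin n → ℝ) :
    ∑ i, x i ^ 2 - ∑ i, (W t).mulVec x i ^ 2
      = ∑ k, (∑ i, W t k i * x i ^ 2 - (∑ i, W t k i * x i) ^ 2) := by
  rw [Finset.sum_sub_distrib, Finset.sum_comm]
  simp only [← Finset.sum_mul, h.col_sum, one_mul, Matrix.mulVec, dotProduct]

-- The self-loop at `b` and the edge from `a` both carry weight `η` and start on different sides.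
theorem IsMixing.half_le_mul_of_adj (h : IsMixing G W η B) (hη : 0 < η) {t : ℕ} {a b : Fin n}
    (hab : (G t).Adj a b) {p : Fin n → Prop} [DecidablePred p] (hp : ¬ (p a ↔ p b)) :
    η / 2 ≤ (∑ i with p i, W t b i) * ∑ i with ¬ p i, W t b i := by
  have hle : ∀ (q : Fin n → Prop) [DecidablePred q], q a ∨ q b → η ≤ ∑ i with q i, W t b i := by
    intro q _ hq
    have hsingle : ∀ i, q i → W t b i ≤ ∑ i with q i, W t b i := fun i hi =>
      Finset.single_le_sum (fun j _ => h.nonneg hη t b j)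
        (Finset.mem_filter.2 ⟨Finset.mem_univ i, hi⟩)
    rcases hq with ha | hb
    · exact (h.weight_of_edge t b a hab).trans (hsingle a ha)
    · exact (h.weight_of_edge t b b (h.self_loop t b)).trans (hsingle b hb)
  have hP : η ≤ ∑ i with p i, W t b i := hle p (by tauto)
  have hQ : η ≤ ∑ i with ¬ p i, W t b i := hle (fun i => ¬ p i) (by tauto)
  have hPQ : ∑ i with p i, W t b i + ∑ i with ¬ p i, W t b i = 1 := by
    rw [Finset.sum_filter_add_sum_filter_not, h.row_sum]
  nlinarith [mul_nonneg (sub_nonneg.2 hP) (sub_nonneg.2 hQ)]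

theorem IsMixing.sum_sq_gap_le_sub (h : IsMixing G W η B) (hη : 0 < η) (t : ℕ)
    {y : ℕ → ℝ} (hy : Monotone y) {r : Fin n → ℕ} {D : Finset ℕ} {x : Fin n → ℝ}
    (hx : ∀ d ∈ D, IsSeparated y r d x)
    (hD : ∀ d ∈ D, ∃ a b, (G t).Adj a b ∧ ¬ (r a ≤ d ↔ r b ≤ d)) :
    η / 2 * ∑ d ∈ D, (y (d + 1) - y d) ^ 2
      ≤ ∑ i, x i ^ 2 - ∑ i, (W t).mulVec x i ^ 2 := by
  have hW := h.nonneg hη t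
  have hcut : ∀ d ∈ D,
      η / 2 ≤ ∑ k, (∑ i with r i ≤ d, W t k i) * ∑ i with ¬ r i ≤ d, W t k i := by
    intro d hd
    obtain ⟨a, b, hab, hcross⟩ := hD d hd
    exact (h.half_le_mul_of_adj hη hab hcross).trans (Finset.single_le_sum
      (f := fun k => (∑ i with r i ≤ d, W t k i) * ∑ i with ¬ r i ≤ d, W t k i)
      (fun k _ => mul_nonneg (Finset.sum_nonneg fun i _ => hW k i)
        (Finset.sum_nonneg fun i _ => hW k i)) (Finset.mem_univ b))
  calc η / 2 * ∑ d ∈ D, (y (d + 1) - y d) ^ 2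
      = ∑ d ∈ D, (y (d + 1) - y d) ^ 2 * (η / 2) := by rw [← Finset.sum_mul, mul_comm]
    _ ≤ ∑ d ∈ D, (y (d + 1) - y d) ^ 2 *
          ∑ k, (∑ i with r i ≤ d, W t k i) * ∑ i with ¬ r i ≤ d, W t k i :=
        Finset.sum_le_sum fun d hd => mul_le_mul_of_nonneg_left (hcut d hd) (sq_nonneg _)
    _ = ∑ k, ∑ d ∈ D, (y (d + 1) - y d) ^ 2 *
          ((∑ i with r i ≤ d, W t k i) * ∑ i with ¬ r i ≤ d, W t k i) := by
        simp only [Finset.mul_sum (s := Finset.univ)]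
        exact Finset.sum_comm
    _ ≤ ∑ k, (∑ i, W t k i * x i ^ 2 - (∑ i, W t k i * x i) ^ 2) :=
        Finset.sum_le_sum fun k _ => sum_sq_gap_mul_le hy hx (hW k) (h.row_sum t k)
    _ = _ := (h.sum_sq_sub_sum_sq_mulVec t x).symm

theorem IsMixing.sqDeviation_mulVec_le (h : IsMixing G W η B) (hη : 0 < η) (t : ℕ)
    (x : Fin n → ℝ) : sqDeviation ((W t).mulVec x) ≤ sqDeviation x := by
  rw [sqDeviation_eq, sqDeviation_eq, h.sum_mulVec]
  have hsq := h.sum_sq_gap_le_sub hη t (y := 0) monotone_const (r := 0) (D := ∅) (x := x)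
    (by simp) (by simp)
  simp only [Finset.sum_empty, mul_zero] at hsq
  linarith

/-- No edge of the graphs `G 0, …, G (m - 1)` crosses the cut of the ranking `r` between the ranks
`d` and `d + 1`. -/
def Uncrossed (G : ℕ → Digraph (Fin n)) (r : Fin n → ℕ) (m d : ℕ) : Prop :=
  ∀ s < m, ∀ a b, (G s).Adj a b → (r a ≤ d ↔ r b ≤ d)

theorem uncrossed_succ_iff {r : Fin n → ℕ} {m d : ℕ} :
    Uncrossed G r (m + 1) d ↔
      Uncrossed G r m d ∧ ∀ a b, (G m).Adj a b → (r a ≤ d ↔ r b ≤ d) :=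
  Nat.forall_lt_succ_right

theorem IsMixing.not_uncrossed (h : IsMixing G W η B) {r : Fin n → ℕ} {d : ℕ} {i j : Fin n}
    (hi : r i ≤ d) (hj : d < r j) : ¬ Uncrossed G r B d := by
  intro hU
  have hreach : ∀ k, Relation.ReflTransGen
      (fun a b => ∃ t, 0 ≤ t ∧ t < 0 + B ∧ (G t).Adj a b) i k → r k ≤ d := by
    intro k hk
    induction hk with
    | refl => exact hi
    | tail _ hab ih =>
      obtain ⟨t, -, ht, hab⟩ := hab
      exact (hU t (by omega) _ _ hab).1 ih
  exact not_le.2 hj (hreach j (h.connected 0 i j))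

variable (h : IsMixing G W η B) {x : ℕ → Fin n → ℝ} (hx : ∀ t, x (t + 1) = (W t).mulVec (x t))

include h hx

theorem IsMixing.sum_eq_sum_zero (m : ℕ) : ∑ i, x m i = ∑ i, x 0 i := by
  induction m with
  | zero => rfl
  | succ m ih => rw [hx, h.sum_mulVec, ih]

variable (hη : 0 < η)

include hη

theorem IsMixing.isSeparated_of_uncrossed {y : ℕ → ℝ} {r : Fin n → ℕ} {d : ℕ}
    (hsep : IsSeparated y r d (x 0)) {m : ℕ} (hU : Uncrossed G r m d) :
    IsSeparated y r d (x m) := by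
  induction m with
  | zero => exact hsep
  | succ m ih =>
    obtain ⟨hUm, hm⟩ := uncrossed_succ_iff.1 hU
    rw [hx]
    exact h.isSeparated_mulVec hη (ih hUm) hm

open Classical in
-- Each cut is charged to the step at which it is crossed first: until then it separates the values.
theorem IsMixing.sum_sq_gap_crossed_le {y : ℕ → ℝ} (hy : Monotone y) {r : Fin n → ℕ}
    (hsep : ∀ d, IsSeparated y r d (x 0)) (D : Finset ℕ) (m : ℕ) :
    η / 2 * ∑ d ∈ D with ¬ Uncrossed G r m d, (y (d + 1) - y d) ^ 2
      ≤ ∑ i, x 0 i ^ 2 - ∑ i, x m i ^ 2 := by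
  induction m with
  | zero => simp [Uncrossed]
  | succ m ih =>
    set first := D.filter fun d => Uncrossed G r m d ∧
      ¬ ∀ a b, (G m).Adj a b → (r a ≤ d ↔ r b ≤ d)
    have hsplit : (D.filter fun d => ¬ Uncrossed G r (m + 1) d)
        = (D.filter fun d => ¬ Uncrossed G r m d) ∪ first := by
      rw [← Finset.filter_or]
      refine Finset.filter_congr fun d _ => ?_
      rw [uncrossed_succ_iff, not_and_or]
      by_cases hU : Uncrossed G r m d <;> simp [hU]
    have hdisj : Disjoint (D.filter fun d => ¬ Uncrossed G r m d) first :=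
      Finset.disjoint_filter.2 fun d _ hcrossed hfirst => hcrossed hfirst.1
    have hstep := h.sum_sq_gap_le_sub hη m hy (D := first) (x := x m)
      (fun d hd => h.isSeparated_of_uncrossed hx hη (hsep d) (Finset.mem_filter.1 hd).2.1)
      (fun d hd => by simpa only [not_forall, exists_prop] using (Finset.mem_filter.1 hd).2.2)
    rw [← hx] at hstep
    rw [hsplit, Finset.sum_union hdisj, mul_add]
    linarith

theorem IsMixing.sqDeviation_window_le :
    sqDeviation (x B) ≤ (1 - η / (2 * (n : ℝ) ^ 2)) * sqDeviation (x 0) := by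
  classical
  rcases n.eq_zero_or_pos with rfl | hn
  · simp [sqDeviation]
  obtain ⟨y, r, hy, hr⟩ := exists_monotone_ranking (x 0)
  have hdrop := h.sum_sq_gap_crossed_le hx hη hy (r := fun i => r i)
    (isSeparated_of_eq_ranking hy hr) (Finset.range (n - 1)) B
  rw [Finset.filter_true_of_mem fun d hd => ?_] at hdrop
  · have hdiff : sqDeviation (x 0) - sqDeviation (x B) = ∑ i, x 0 i ^ 2 - ∑ i, x B i ^ 2 := by
      rw [sqDeviation_eq, sqDeviation_eq, h.sum_eq_sum_zero hx B]
      ring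
    have hgap : η / (2 * (n : ℝ) ^ 2) * sqDeviation (x 0)
        ≤ η / 2 * ∑ d ∈ Finset.range (n - 1), (y (d + 1) - y d) ^ 2 :=
      calc η / (2 * (n : ℝ) ^ 2) * sqDeviation (x 0)
          ≤ η / (2 * (n : ℝ) ^ 2) *
            ((n : ℝ) ^ 2 * ∑ d ∈ Finset.range (n - 1), (y (d + 1) - y d) ^ 2) := by
            gcongr
            exact sqDeviation_le_sum_sq_gap hy hr
        _ = _ := by field_simp
    linarith
  · have hd : d < n - 1 := Finset.mem_range.1 hd
    exact h.not_uncrossed (i := r.symm ⟨0, hn⟩) (j := r.symm ⟨n - 1, by omega⟩)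
      (by simp) (by simpa using hd)

theorem IsMixing.sqDeviation_antitone : Antitone fun m => sqDeviation (x m) :=
  antitone_nat_of_succ_le fun m => by
    rw [hx]
    exact h.sqDeviation_mulVec_le hη m (x m)

theorem IsMixing.sqDeviation_le_pow (m : ℕ) :
    sqDeviation (x m) ≤ ((1 - η / (4 * (n : ℝ) ^ 2)) ^ (m / B)) ^ 2 * sqDeviation (x 0) := by
  set q := 1 - η / (4 * (n : ℝ) ^ 2)
  have hwindow : ∀ c, sqDeviation (x (B * c + B)) ≤ q ^ 2 * sqDeviation (x (B * c)) := fun c => by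
    refine ((h.shift (B * c)).sqDeviation_window_le (x := fun t => x (B * c + t))
      (fun t => hx (B * c + t)) hη).trans (mul_le_mul_of_nonneg_right ?_ (sqDeviation_nonneg _))
    have hq : q ^ 2 - (1 - η / (2 * (n : ℝ) ^ 2)) = (η / (4 * (n : ℝ) ^ 2)) ^ 2 := by ring
    linarith [sq_nonneg (η / (4 * (n : ℝ) ^ 2))]
  have hwindows : ∀ c, sqDeviation (x (B * c)) ≤ (q ^ c) ^ 2 * sqDeviation (x 0) := by
    intro c
    induction c with
    | zero => simp
    | succ c ih =>
      calc sqDeviation (x (B * c + B)) ≤ q ^ 2 * sqDeviation (x (B * c)) := hwindow c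
        _ ≤ q ^ 2 * ((q ^ c) ^ 2 * sqDeviation (x 0)) := by gcongr
        _ = (q ^ (c + 1)) ^ 2 * sqDeviation (x 0) := by ring
  exact (h.sqDeviation_antitone hx hη (Nat.mul_div_le m B)).trans (hwindows _)

end Mixing

/-! ### Transition matrices and perturbed averaging -/

section Transition

variable {n : ℕ} {G : ℕ → Digraph (Fin n)} {W : ℕ → Matrix (Fin n) (Fin n) ℝ} {η : ℝ} {B : ℕ}

theorem one_sub_div_mem_Ioo (hη : 0 < η ∧ η < 1) (hn : 0 < n) :
    1 - η / (4 * (n : ℝ) ^ 2) ∈ Set.Ioo 0 1 := by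
  have hn' : (1 : ℝ) ≤ n := by exact_mod_cast hn
  have hpos : 0 < η / (4 * (n : ℝ) ^ 2) := div_pos hη.1 (by positivity)
  have hlt : η / (4 * (n : ℝ) ^ 2) < 1 := by
    rw [div_lt_one (by positivity)]
    nlinarith [hη.2]
  exact ⟨sub_pos.2 hlt, sub_lt_self 1 hpos⟩

theorem theta_pos (hη : 0 < η ∧ η < 1) (hn : 0 < n) : 0 < theta η n B :=
  Real.rpow_pos_of_pos (one_sub_div_mem_Ioo hη hn).1 _

theorem theta_lt_one (hη : 0 < η ∧ η < 1) (hn : 0 < n) (hB : 1 ≤ B) : theta η n B < 1 :=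
  Real.rpow_lt_one (one_sub_div_mem_Ioo hη hn).1.le (one_sub_div_mem_Ioo hη hn).2
    (one_div_pos.2 (by exact_mod_cast hB))

theorem Gam_pos (hη : 0 < η ∧ η < 1) (hn : 0 < n) : 0 < Gam η n :=
  inv_pos.2 (pow_pos (one_sub_div_mem_Ioo hη hn).1 2)

theorem pow_div_le_Gam_mul_theta_pow (hη : 0 < η ∧ η < 1) (hn : 0 < n) (hB : 1 ≤ B) (m : ℕ) :
    (1 - η / (4 * (n : ℝ) ^ 2)) ^ (m / B) ≤ Gam η n * theta η n B ^ m := by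
  obtain ⟨hq₀, hq₁⟩ := one_sub_div_mem_Ioo hη hn
  unfold Gam theta
  set q := 1 - η / (4 * (n : ℝ) ^ 2)
  have hB' : (0 : ℝ) < B := by exact_mod_cast hB
  have hexp : 1 / (B : ℝ) * m ≤ ((m / B + 2 : ℕ) : ℝ) := by
    have hm : (m : ℝ) ≤ B * ((m / B : ℕ) + 1) := by exact_mod_cast (Nat.lt_mul_div_succ m hB).le
    have hdiv : 1 / (B : ℝ) * m ≤ (m / B : ℕ) + 1 := by
      rw [one_div_mul_eq_div, div_le_iff₀' hB']
      exact hm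
    push_cast
    linarith
  rw [inv_mul_eq_div, le_div_iff₀ (by positivity)]
  calc q ^ (m / B) * q ^ 2 = q ^ ((m / B + 2 : ℕ) : ℝ) := by rw [Real.rpow_natCast, pow_add]
    _ ≤ q ^ (1 / (B : ℝ) * m) := Real.rpow_le_rpow_of_exponent_ge hq₀ hq₁.le hexp
    _ = (q ^ (1 / (B : ℝ))) ^ m := by rw [Real.rpow_mul hq₀.le, Real.rpow_natCast]

/-- The transition matrix `W(s + m - 1) ⋯ W(s)`, which propagates the estimates at time `s` over
the next `m` averaging steps. -/
noncomputable def transition (W : ℕ → Matrix (Fin n) (Fin n) ℝ) (s : ℕ) :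
    ℕ → Matrix (Fin n) (Fin n) ℝ
  | 0 => 1
  | m + 1 => W (s + m) * transition W s m

theorem sqDeviation_pi_single_le_one (j : Fin n) : sqDeviation (Pi.single j 1) ≤ 1 := by
  rw [sqDeviation_eq]
  have hsq : ∑ i, (Pi.single j 1 : Fin n → ℝ) i ^ 2 = 1 := by simp [Pi.single_apply]
  rw [hsq, sub_le_self_iff]
  positivity

theorem IsMixing.abs_transition_sub_le (h : IsMixing G W η B) (hη : 0 < η ∧ η < 1)
    (s m : ℕ) (i j : Fin n) :
    |transition W s m i j - 1 / n| ≤ Gam η n * theta η n B ^ m := by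
  have hn : 0 < n := i.pos
  refine le_trans ?_ (pow_div_le_Gam_mul_theta_pow hη hn h.one_le_window m)
  set col : ℕ → Fin n → ℝ := fun m i => transition W s m i j
  have hcol : ∀ m, col (m + 1) = (W (s + m)).mulVec (col m) := fun _ => rfl
  have hcol₀ : col 0 = Pi.single j 1 := by
    ext i
    simp [col, transition, Matrix.one_apply, Pi.single_apply]
  have havg : avg (col m) = 1 / n := by
    rw [avg, (h.shift s).sum_eq_sum_zero hcol, hcol₀]
    simp
  have hq := (one_sub_div_mem_Ioo hη hn).1
  refine abs_le_of_sq_le_sq ?_ (by positivity)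
  calc (col m i - 1 / n) ^ 2 = (col m i - avg (col m)) ^ 2 := by rw [havg]
    _ ≤ sqDeviation (col m) :=
        Finset.single_le_sum (f := fun i => (col m i - avg (col m)) ^ 2)
          (fun _ _ => sq_nonneg _) (Finset.mem_univ i)
    _ ≤ ((1 - η / (4 * (n : ℝ) ^ 2)) ^ (m / B)) ^ 2 * sqDeviation (col 0) :=
        (h.shift s).sqDeviation_le_pow hcol hη.1 m
    _ ≤ ((1 - η / (4 * (n : ℝ) ^ 2)) ^ (m / B)) ^ 2 := by
        rw [hcol₀]
        exact mul_le_of_le_one_right (by positivity) (sqDeviation_pi_single_le_one j)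

variable {E : Type*} [NormedAddCommGroup E] [NormedSpace ℝ E]

theorem sum_smul_transition (W : ℕ → Matrix (Fin n) (Fin n) ℝ) (s m : ℕ) (z : Fin n → E)
    (i : Fin n) :
    ∑ j, W (s + m) i j • ∑ k, transition W s m j k • z k
      = ∑ k, transition W s (m + 1) i k • z k := by
  simp only [transition, Finset.smul_sum, Matrix.mul_apply, Finset.sum_smul, smul_smul]
  exact Finset.sum_comm

theorem IsMixing.norm_transition_sub_avg_le (h : IsMixing G W η B) (hη : 0 < η ∧ η < 1)
    (s m : ℕ) (z : Fin n → E) (i : Fin n) :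
    ‖∑ j, transition W s m i j • z j - avg z‖ ≤ Gam η n * theta η n B ^ m * ∑ j, ‖z j‖ := by
  have hdiff : ∑ j, transition W s m i j • z j - avg z
      = ∑ j, (transition W s m i j - 1 / n) • z j := by
    simp only [avg, Finset.smul_sum, sub_smul, Finset.sum_sub_distrib]
  rw [hdiff, Finset.mul_sum]
  refine norm_sum_le_of_le _ fun j _ => ?_
  rw [norm_smul, Real.norm_eq_abs]
  exact mul_le_mul_of_nonneg_right (h.abs_transition_sub_le hη s m i j) (norm_nonneg _)

variable {x e : ℕ → Fin n → E} (hx : ∀ t i, x (t + 1) i = ∑ j, W t i j • x t j + e t i)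

include hx

theorem eq_sum_transition (t : ℕ) (i : Fin n) :
    x t i = ∑ j, transition W 0 t i j • x 0 j
      + ∑ s ∈ Finset.range t, ∑ j, transition W (s + 1) (t - 1 - s) i j • e s j := by
  induction t generalizing i with
  | zero => simp [transition, Matrix.one_apply]
  | succ t ih =>
    have hzero : ∑ j, W t i j • ∑ k, transition W 0 t j k • x 0 k
        = ∑ k, transition W 0 (t + 1) i k • x 0 k := by
      simpa only [zero_add] using sum_smul_transition W 0 t (x 0) i
    have hpast : ∀ s ∈ Finset.range t,
        ∑ j, W t i j • ∑ k, transition W (s + 1) (t - 1 - s) j k • e s k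
          = ∑ k, transition W (s + 1) (t - s) i k • e s k := fun s hs => by
      have hst : s < t := Finset.mem_range.1 hs
      have := sum_smul_transition W (s + 1) (t - 1 - s) (e s) i
      rwa [show s + 1 + (t - 1 - s) = t by omega, show t - 1 - s + 1 = t - s by omega] at this
    have hlast : ∑ j, transition W (t + 1) (t - t) i j • e t j = e t i := by
      simp [transition, Matrix.one_apply]
    rw [hx, Finset.sum_range_succ, Nat.add_sub_cancel, hlast, ← add_assoc, ← hzero,
      ← Finset.sum_congr rfl hpast, Finset.sum_comm]
    simp only [ih, smul_add, Finset.sum_add_distrib, Finset.smul_sum (s := Finset.range t)]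

theorem IsMixing.avg_eq (h : IsMixing G W η B) (t : ℕ) :
    avg (x t) = avg (x 0) + ∑ s ∈ Finset.range t, avg (e s) := by
  induction t with
  | zero => simp
  | succ t ih =>
    have hsum : ∑ i, x (t + 1) i = ∑ j, x t j + ∑ j, e t j := by
      simp only [hx, Finset.sum_add_distrib]
      rw [Finset.sum_comm]
      simp only [← Finset.sum_smul, h.col_sum, one_smul]
    rw [Finset.sum_range_succ, ← add_assoc, ← ih]
    simp only [avg, hsum, smul_add]

theorem IsMixing.norm_sub_avg_le (h : IsMixing G W η B) (hη : 0 < η ∧ η < 1) (t : ℕ) (i : Fin n) :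
    ‖x t i - avg (x t)‖ ≤ Gam η n * theta η n B ^ t * ∑ j, ‖x 0 j‖
      + ∑ s ∈ Finset.range t, Gam η n * theta η n B ^ (t - 1 - s) * ∑ j, ‖e s j‖ := by
  have hdiff : x t i - avg (x t) = (∑ j, transition W 0 t i j • x 0 j - avg (x 0))
      + ∑ s ∈ Finset.range t,
        (∑ j, transition W (s + 1) (t - 1 - s) i j • e s j - avg (e s)) := by
    rw [Finset.sum_sub_distrib, h.avg_eq hx t, eq_sum_transition hx t i]
    abel
  rw [hdiff]
  exact (norm_add_le _ _).trans (add_le_add (h.norm_transition_sub_avg_le hη 0 t (x 0) i)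
    (norm_sum_le_of_le _ fun s _ => h.norm_transition_sub_avg_le hη (s + 1) (t - 1 - s) (e s) i))

end Transition

/-! ### Mirror descent -/

section Prox

variable {E : Type*} [NormedAddCommGroup E] [NormedSpace ℝ E] {X : Set E} {ψ : E → ℝ}

theorem le_of_forall_one_sub_mul_le {a b : ℝ} (h : ∀ t ∈ Set.Ioo (0 : ℝ) 1, (1 - t) * a ≤ b) :
    a ≤ b := by
  have hlim : Tendsto (fun t : ℝ => (1 - t) * a) (𝓝[>] 0) (𝓝 ((1 - 0) * a)) :=
    (Continuous.tendsto (by fun_prop) 0).mono_left nhdsWithin_le_nhds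
  rw [sub_zero, one_mul] at hlim
  exact le_of_tendsto hlim (eventually_of_mem (Ioo_mem_nhdsGT zero_lt_one) h)

theorem add_sq_le_of_strongConvexOn {m : ℝ} {h : E → ℝ} (hh : StrongConvexOn X m h) {p : E}
    (hp : p ∈ X) (hmin : IsMinOn h X p) {x : E} (hx : x ∈ X) :
    h p + m / 2 * ‖x - p‖ ^ 2 ≤ h x := by
  suffices m / 2 * ‖x - p‖ ^ 2 ≤ h x - h p by linarith
  refine le_of_forall_one_sub_mul_le fun t ht => ?_
  have hconv := hh.2 hx hp ht.1.le (sub_nonneg.2 ht.2.le) (by ring)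
  have hle : h p ≤ h (t • x + (1 - t) • p) :=
    hmin (hh.1 hx hp ht.1.le (sub_nonneg.2 ht.2.le) (by ring))
  simp only [smul_eq_mul] at hconv
  refine le_of_mul_le_mul_left (a := t) ?_ ht.1
  linarith

theorem fderiv_apply_sub_le_of_convexOn (hψ : ConvexOn ℝ X ψ) {v x : E} (hv : v ∈ X) (hx : x ∈ X)
    (hd : DifferentiableAt ℝ ψ v) : fderiv ℝ ψ v (x - v) ≤ ψ x - ψ v := by
  have hline : HasDerivAt (ψ ∘ AffineMap.lineMap v x) (fderiv ℝ ψ v (x - v)) (0 : ℝ) := by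
    refine HasFDerivAt.comp_hasDerivAt (0 : ℝ) ?_ AffineMap.hasDerivAt_lineMap
    simpa using hd.hasFDerivAt
  have := (hψ.comp_affineMap (AffineMap.lineMap v x)).le_slope_of_hasDerivWithinAt
    (by simpa using hv) (by simpa using hx) (zero_lt_one' ℝ) hline.hasDerivWithinAt
  simpa [slope_def_field] using this

theorem strongConvexOn_sub_apply {m : ℝ} (hψ : StrongConvexOn X m ψ) (z : StrongDual ℝ E) :
    StrongConvexOn X m (fun x => ψ x - z x) := by
  have hz : ConcaveOn ℝ X (fun x => z x) := z.toLinearMap.concaveOn hψ.1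
  have := hψ.sub (uniformConcaveOn_zero.2 hz)
  rwa [add_zero] at this

theorem norm_sub_le_of_isMinOn (hψ : StrongConvexOn X 1 ψ) {z z' : StrongDual ℝ E} {p p' : E}
    (hp : p ∈ X) (hp' : p' ∈ X) (hmin : IsMinOn (fun x => ψ x - z x) X p)
    (hmin' : IsMinOn (fun x => ψ x - z' x) X p') : ‖p - p'‖ ≤ ‖z - z'‖ := by
  have hgrow := add_sq_le_of_strongConvexOn (strongConvexOn_sub_apply hψ z) hp hmin hp'
  have hgrow' := add_sq_le_of_strongConvexOn (strongConvexOn_sub_apply hψ z') hp' hmin' hp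
  have hdual : (z - z') (p - p') ≤ ‖z - z'‖ * ‖p - p'‖ :=
    (le_abs_self _).trans ((z - z').le_opNorm _)
  rw [norm_sub_rev p' p] at hgrow
  simp only [sub_apply, map_sub] at hdual
  rcases (norm_nonneg (p - p')).eq_or_lt with h0 | h0
  · exact h0 ▸ norm_nonneg _
  · refine le_of_mul_le_mul_right ?_ h0
    linarith

theorem isMinOn_sub_fderiv (hψ : IsRegularizer X ψ) {v : E} (hv : v ∈ X) :
    IsMinOn (fun x => ψ x - fderiv ℝ ψ v x) X v := fun x hx => by
  have := fderiv_apply_sub_le_of_convexOn (hψ.strongConvex.strictConvexOn one_pos).convexOn hv hx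
    (hψ.differentiable v hv)
  simp only [Set.mem_ofPred_eq, map_sub] at this ⊢
  linarith

theorem IsRegularizer.half_sq_le_bregman (hψ : IsRegularizer X ψ) {p v : E} (hp : p ∈ X)
    (hv : v ∈ X) : 1 / 2 * ‖p - v‖ ^ 2 ≤ bregman ψ p v := by
  have := add_sq_le_of_strongConvexOn (strongConvexOn_sub_apply hψ.strongConvex (fderiv ℝ ψ v)) hv
    (isMinOn_sub_fderiv hψ hv) hp
  simp only [bregman, map_sub]
  linarith

theorem IsProx.isMinOn {v p : E} {y : StrongDual ℝ E} (h : IsProx X ψ v y p) :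
    IsMinOn (fun x => ψ x - (fderiv ℝ ψ v + y) x) X p := fun x hx => by
  have := h.2 x hx
  simp only [bregman, Set.mem_ofPred_eq, map_sub, add_apply] at this ⊢
  linarith

theorem IsProx.mem_iterate {x v : ℕ → E} {y : ℕ → StrongDual ℝ E} (hx₀ : x 0 ∈ X)
    (h : ∀ t, IsProx X ψ (v t) (y t) (x (t + 1))) : ∀ t, x t ∈ X
  | 0 => hx₀
  | t + 1 => (h t).1

theorem IsProx.norm_sub_le (hψ : IsRegularizer X ψ) {v p : E} {y : StrongDual ℝ E}
    (h : IsProx X ψ v y p) (hv : v ∈ X) : ‖p - v‖ ≤ ‖y‖ := by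
  simpa using norm_sub_le_of_isMinOn hψ.strongConvex h.1 hv h.isMinOn (isMinOn_sub_fderiv hψ hv)

theorem IsProx.apply_sub_le (hψ : IsRegularizer X ψ) {v p : E} {y : StrongDual ℝ E}
    (h : IsProx X ψ v y p) {x : E} (hx : x ∈ X) :
    y (x - p) ≤ bregman ψ x v - bregman ψ x p - bregman ψ p v := by
  have hd : HasFDerivAt (fun x => ψ x - (fderiv ℝ ψ v + y) x)
      (fderiv ℝ ψ p - (fderiv ℝ ψ v + y)) p :=
    (hψ.differentiable p h.1).hasFDerivAt.sub (ContinuousLinearMap.hasFDerivAt _)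
  have hnonneg := h.isMinOn.localize.hasFDerivWithinAt_nonneg hd.hasFDerivWithinAt
    (sub_mem_posTangentConeAt_of_segment_subset (hψ.strongConvex.1.segment_subset h.1 hx))
  simp only [sub_apply, add_apply, map_sub, bregman] at hnonneg ⊢
  linarith

theorem IsProx.mul_apply_sub_le (hψ : IsRegularizer X ψ) {v p : E} {g : StrongDual ℝ E} {a : ℝ}
    (h : IsProx X ψ v (-(a • g)) p) (hv : v ∈ X) {x : E} (hx : x ∈ X) :
    a * g (v - x) ≤ bregman ψ x v - bregman ψ x p + a ^ 2 / 2 * ‖g‖ ^ 2 := by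
  have hthree := h.apply_sub_le hψ hx
  have hhalf := hψ.half_sq_le_bregman h.1 hv
  have hdual : a * g (v - p) ≤ ‖a • g‖ * ‖p - v‖ := by
    rw [norm_sub_rev]
    exact (le_abs_self _).trans ((a • g).le_opNorm (v - p))
  have hyoung := two_mul_le_add_sq ‖a • g‖ ‖p - v‖
  have hsq : ‖a • g‖ ^ 2 = a ^ 2 * ‖g‖ ^ 2 := by rw [norm_smul, mul_pow, Real.norm_eq_abs, sq_abs]
  simp only [neg_apply, smul_apply, smul_eq_mul, map_sub] at hthree hdual ⊢
  linarith

theorem IsProx.exists_continuous (hne : X.Nonempty) (hX : IsCompact X) (hψ : IsRegularizer X ψ) :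
    ∃ Q : StrongDual ℝ E → E, Continuous Q ∧
      ∀ v y p, IsProx X ψ v y p → p = Q (fderiv ℝ ψ v + y) := by
  have hcont : ContinuousOn ψ X := fun x hx =>
    (hψ.differentiable x hx).continuousAt.continuousWithinAt
  have hex : ∀ z : StrongDual ℝ E, ∃ p ∈ X, IsMinOn (fun x => ψ x - z x) X p := fun z =>
    hX.exists_isMinOn hne (hcont.sub z.continuous.continuousOn)
  choose Q hQ hQmin using hex
  refine ⟨Q, (LipschitzWith.of_dist_le_mul (K := 1) fun z z' => ?_).continuous, fun v y p h => ?_⟩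
  · rw [dist_eq_norm, dist_eq_norm, NNReal.coe_one, one_mul]
    exact norm_sub_le_of_isMinOn hψ.strongConvex (hQ z) (hQ z') (hQmin z) (hQmin z')
  · have := norm_sub_le_of_isMinOn hψ.strongConvex h.1 (hQ (fderiv ℝ ψ v + y)) h.isMinOn
      (hQmin (fderiv ℝ ψ v + y))
    rwa [sub_self, norm_zero, norm_le_zero_iff, sub_eq_zero] at this

theorem IsProx.measurable [FiniteDimensional ℝ E] [MeasurableSpace E] [BorelSpace E]
    {Ω : Type*} {m : MeasurableSpace Ω} (hne : X.Nonempty) (hX : IsCompact X)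
    (hψ : IsRegularizer X ψ) {v p : Ω → E} {y : Ω → StrongDual ℝ E} (hv : Measurable v)
    (hy : StronglyMeasurable y) (h : ∀ ω, IsProx X ψ (v ω) (y ω) (p ω)) : Measurable p := by
  obtain ⟨Q, hQ, hQp⟩ := IsProx.exists_continuous hne hX hψ
  rw [funext fun ω => hQp _ _ _ (h ω)]
  have : FiniteDimensional ℝ (E →L[ℝ] ℝ) := inferInstance
  have : ProperSpace (E →L[ℝ] ℝ) := FiniteDimensional.proper_real _
  exact hQ.measurable.comp (((measurable_fderiv ℝ ψ).comp hv).add hy.measurable)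

theorem norm_le_of_mem_subdiff {O : Set E} {h : E → ℝ} {x : E} {g : StrongDual ℝ E} {L : ℝ}
    (hO : IsOpen O) (hx : x ∈ O) (hL : 0 ≤ L) (hh : ∀ y ∈ O, h y - h x ≤ L * ‖y - x‖)
    (hg : g ∈ subdiff O h x) : ‖g‖ ≤ L := by
  obtain ⟨ε, hε, hball⟩ := Metric.isOpen_iff.1 hO x hx
  have hle : ∀ z : E, ‖z‖ < ε → g z ≤ L * ‖z‖ := fun z hz => by
    have hm : x + z ∈ O := hball (by simpa [dist_eq_norm] using hz)
    have hsub := hg _ hm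
    have hlip := hh _ hm
    rw [add_sub_cancel_left] at hsub hlip
    linarith
  refine ContinuousLinearMap.opNorm_le_of_ball hε hL fun z hz => ?_
  rw [mem_ball_zero_iff] at hz
  refine abs_le'.2 ⟨hle z hz, ?_⟩
  simpa using hle (-z) (by rwa [norm_neg])

end Prox

/-! ### Stochastic subgradients -/

section Sampling

variable {Ω : Type*} {m mΩ : MeasurableSpace Ω} {P : Measure Ω}

theorem integral_le_of_condExp_le [IsProbabilityMeasure P] (hm : m ≤ mΩ) {h : Ω → ℝ} {c : ℝ}
    (hc : P[h | m] ≤ᵐ[P] fun _ => c) : ∫ ω, h ω ∂P ≤ c := by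
  rw [← integral_condExp hm]
  exact (integral_mono_ae integrable_condExp (integrable_const _) hc).trans_eq (by simp)

theorem integral_le_of_integral_sq_le [IsProbabilityMeasure P] {h : Ω → ℝ} (hh : MemLp h 2 P)
    {c : ℝ} (hc : 0 ≤ c) (hsq : ∫ ω, h ω ^ 2 ∂P ≤ c ^ 2) : ∫ ω, h ω ∂P ≤ c := by
  have hvar := variance_nonneg h P
  rw [variance_eq_sub hh, sub_nonneg] at hvar
  exact le_of_abs_le (abs_le_of_sq_le_sq (hvar.trans hsq) hc)

theorem norm_sq_le_of_norm_le {E : Type*} [SeminormedAddCommGroup E] {a b : E} {L ν : ℝ}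
    (hν : 0 < ν) (ha : ‖a‖ ≤ L) : ‖b‖ ^ 2 ≤ L * (L + ν) + (1 + L / ν) * ‖a - b‖ ^ 2 := by
  have hL : 0 ≤ L := (norm_nonneg a).trans ha
  have htri : ‖b‖ ≤ L + ‖a - b‖ := (norm_le_norm_add_norm_sub a b).trans (by gcongr)
  have hyoung : 0 ≤ L / ν * (ν - ‖a - b‖) ^ 2 := by positivity
  calc ‖b‖ ^ 2 ≤ (L + ‖a - b‖) ^ 2 := by gcongr
    _ = L * (L + ν) + (1 + L / ν) * ‖a - b‖ ^ 2 - L / ν * (ν - ‖a - b‖) ^ 2 := by field_simp; ring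
    _ ≤ _ := by linarith

variable {E : Type*} [NormedAddCommGroup E]

theorem memLp_two_of_ae_norm_le [IsFiniteMeasure P] {g ghat : Ω → E} {L ν : ℝ} (hν : 0 < ν)
    (hg : ∀ᵐ ω ∂P, ‖g ω‖ ≤ L) (hghat : AEStronglyMeasurable ghat P)
    (hsq : Integrable (fun ω => ‖g ω - ghat ω‖ ^ 2) P) : MemLp ghat 2 P := by
  rw [memLp_two_iff_integrable_sq_norm hghat]
  refine ((integrable_const (L * (L + ν))).add (hsq.const_mul (1 + L / ν))).mono'
    (hghat.norm.pow 2) (hg.mono fun ω h => ?_)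
  rw [Real.norm_of_nonneg (by positivity)]
  exact norm_sq_le_of_norm_le hν h

theorem integral_norm_sq_le_of_ae_norm_le [IsProbabilityMeasure P] {g ghat : Ω → E} {L ν : ℝ}
    (hν : 0 < ν) (hL : 0 ≤ L) (hg : ∀ᵐ ω ∂P, ‖g ω‖ ≤ L)
    (hsq : Integrable (fun ω => ‖g ω - ghat ω‖ ^ 2) P)
    (hvar : ∫ ω, ‖g ω - ghat ω‖ ^ 2 ∂P ≤ ν ^ 2) (hghat : MemLp ghat 2 P) :
    ∫ ω, ‖ghat ω‖ ^ 2 ∂P ≤ (L + ν) ^ 2 :=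
  calc ∫ ω, ‖ghat ω‖ ^ 2 ∂P ≤ ∫ ω, (L * (L + ν) + (1 + L / ν) * ‖g ω - ghat ω‖ ^ 2) ∂P :=
        integral_mono_ae (hghat.integrable_norm_pow two_ne_zero)
          ((integrable_const _).add (hsq.const_mul _))
          (hg.mono fun _ h => norm_sq_le_of_norm_le hν h)
    _ = L * (L + ν) + (1 + L / ν) * ∫ ω, ‖g ω - ghat ω‖ ^ 2 ∂P := by
        rw [integral_add (integrable_const _) (hsq.const_mul _), integral_const, probReal_univ,
          one_smul, integral_const_mul]
    _ ≤ L * (L + ν) + (1 + L / ν) * ν ^ 2 := by gcongr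
    _ = (L + ν) ^ 2 := by field_simp; ring

variable [NormedSpace ℝ E]

theorem integrable_apply {g : Ω → StrongDual ℝ E} {v : Ω → E} (hg : Integrable g P)
    (hv : AEStronglyMeasurable v P) {C : ℝ} (hC : ∀ ω, ‖v ω‖ ≤ C) :
    Integrable (fun ω => g ω (v ω)) P :=
  (ContinuousLinearMap.id ℝ (StrongDual ℝ E)).integrable_of_bilin_of_bdd_right C hg hv
    (ae_of_all _ hC)

theorem integral_apply_eq_of_condExp [FiniteDimensional ℝ E] [IsFiniteMeasure P]
    {g ghat : Ω → StrongDual ℝ E} {v : Ω → E} (hm : m ≤ mΩ) (hghat : Integrable ghat P)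
    (hg : P[ghat | m] =ᵐ[P] g) (hv : StronglyMeasurable[m] v) {C : ℝ} (hC : ∀ ω, ‖v ω‖ ≤ C) :
    ∫ ω, ghat ω (v ω) ∂P = ∫ ω, g ω (v ω) ∂P := by
  have hint := integrable_apply hghat (hv.mono hm).aestronglyMeasurable hC
  have hpull := condExp_bilin_of_stronglyMeasurable_right
    (ContinuousLinearMap.id ℝ (StrongDual ℝ E)) hv hint hghat
  rw [← integral_condExp hm]
  refine integral_congr_ae ?_
  filter_upwards [hpull, hg] with ω hω hgω
  rw [← hgω]
  exact hω

end Sampling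

/-! ### Weighted averages and weighted sums -/

section Averages

theorem one_div_mul_sum_le {n : ℕ} (hn : 0 < n) {a : Fin n → ℝ} {c : ℝ} (ha : ∀ i, a i ≤ c) :
    1 / (n : ℝ) * ∑ i, a i ≤ c := by
  rw [one_div, inv_mul_le_iff₀ (by exact_mod_cast hn)]
  simpa using Finset.sum_le_card_nsmul Finset.univ a c fun i _ => ha i

variable {E : Type*} [NormedAddCommGroup E] [NormedSpace ℝ E]

theorem norm_sub_le_of_mem_convexHull {s : Set E} {x c : E} {r : ℝ} (hx : x ∈ convexHull ℝ s)
    (hs : ∀ y ∈ s, ‖y - c‖ ≤ r) : ‖x - c‖ ≤ r :=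
  mem_closedBall_iff_norm.1 <| convexHull_min (fun y hy => mem_closedBall_iff_norm.2 (hs y hy))
    (convex_closedBall c r) hx

theorem sum_map_sum_smul_le {ι : Type*} [Fintype ι] [DecidableEq ι] {X : Set E} {h : E → ℝ}
    (hh : ConvexOn ℝ X h) {A : Matrix ι ι ℝ} (hA : A ∈ doublyStochastic ℝ ι) {x : ι → E}
    (hx : ∀ j, x j ∈ X) : ∑ i, h (∑ j, A i j • x j) ≤ ∑ j, h (x j) :=
  calc ∑ i, h (∑ j, A i j • x j) ≤ ∑ i, ∑ j, A i j * h (x j) :=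
        Finset.sum_le_sum fun i _ =>
          hh.map_sum_le (fun _ _ => nonneg_of_mem_doublyStochastic hA)
            (sum_row_of_mem_doublyStochastic hA i) fun j _ => hx j
    _ = ∑ j, h (x j) := by
        rw [Finset.sum_comm]
        simp only [← Finset.sum_mul, sum_col_of_mem_doublyStochastic hA, one_mul]

variable {Ω : Type*} {n : ℕ} {w : Fin n → ℝ} {x : Fin n → ℕ → Ω → E} {t : ℕ}

theorem mix_mem_convexHull (hw₀ : ∀ j, 0 ≤ w j) (hw : ∑ j, w j = 1) (ω : Ω) :
    mix w x t ω ∈ convexHull ℝ (Set.range fun j => x j t ω) :=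
  (convex_convexHull ℝ _).sum_mem (fun j _ => hw₀ j) hw fun j _ =>
    subset_convexHull ℝ _ (Set.mem_range_self j)

theorem mem_of_mem_convexHull_range {X : Set E} (hX : Convex ℝ X) {ι : Type*} {z : ι → E} {p : E}
    (hz : ∀ j, z j ∈ X) (hp : p ∈ convexHull ℝ (Set.range z)) : p ∈ X :=
  convexHull_min (Set.range_subset_iff.2 hz) hX hp

theorem measurable_mix {m : MeasurableSpace Ω} [FiniteDimensional ℝ E] [MeasurableSpace E]
    [BorelSpace E] (hx : ∀ j, Measurable (x j t)) : Measurable (mix w x t) := by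
  have : ProperSpace E := FiniteDimensional.proper_real E
  exact Finset.measurable_fun_sum _ fun j _ => (hx j).const_smul (w j)

end Averages

section WeightedSums

variable {θ : ℝ}

theorem geom_sum_le_one_div (h0 : 0 ≤ θ) (h1 : θ < 1) (T : ℕ) :
    ∑ t ∈ Finset.range T, θ ^ t ≤ 1 / (1 - θ) := by
  rw [le_div_iff₀ (sub_pos.2 h1), mul_comm, mul_neg_geom_sum]
  exact sub_le_self 1 (pow_nonneg h0 T)

theorem sum_sum_geom_le (h0 : 0 ≤ θ) (h1 : θ < 1) {a : ℕ → ℝ} (ha : ∀ t, 0 ≤ a t) (T : ℕ) :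
    ∑ t ∈ Finset.range T, ∑ s ∈ Finset.range t, θ ^ (t - 1 - s) * a s
      ≤ (∑ s ∈ Finset.range T, a s) / (1 - θ) := by
  set S : ℕ → ℝ := fun t => ∑ s ∈ Finset.range t, θ ^ (t - 1 - s) * a s with hS
  have hrec : ∀ t, S (t + 1) = θ * S t + a t := by
    intro t
    simp only [hS]
    rw [Finset.sum_range_succ, Finset.mul_sum]
    congr 1
    · refine Finset.sum_congr rfl fun s hs => ?_
      rw [show t + 1 - 1 - s = t - 1 - s + 1 by have := Finset.mem_range.1 hs; omega, pow_succ']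
      ring
    · simp
  have hsum : (1 - θ) * ∑ t ∈ Finset.range T, S t + S T = ∑ s ∈ Finset.range T, a s := by
    induction T with
    | zero => simp [hS]
    | succ T ih => rw [Finset.sum_range_succ, Finset.sum_range_succ, hrec, ← ih]; ring
  have hST : 0 ≤ S T := Finset.sum_nonneg fun s _ => mul_nonneg (pow_nonneg h0 _) (ha s)
  rw [le_div_iff₀ (sub_pos.2 h1)]
  linarith

theorem tendsto_zero_of_le_mul_add_mul_div {e A q : ℕ → ℝ} {c a b : ℝ} (hc : 0 ≤ c) (hb : 0 ≤ b)
    (he₀ : ∀ t, 0 ≤ e t) (hq₀ : ∀ t, 0 ≤ q t) (hq : Summable q) (hA : Tendsto A atTop atTop)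
    (he : ∀ t, 0 < A t → e t ≤ c * ((a + b * ∑ s ∈ Finset.range t, q s) / A t)) :
    Tendsto e atTop (𝓝 0) := by
  have hlim : Tendsto (fun t => c * ((a + b * ∑' s, q s) / A t)) atTop (𝓝 0) := by
    simpa using (hA.const_div_atTop (a + b * ∑' s, q s)).const_mul c
  refine squeeze_zero' (Eventually.of_forall he₀) ?_ hlim
  filter_upwards [hA.eventually_gt_atTop 0] with t ht
  refine (he t ht).trans ?_
  gcongr
  exact hq.sum_le_tsum _ fun s _ => hq₀ s

end WeightedSums

theorem IsMixing.mem_doublyStochastic {n : ℕ} {G : ℕ → Digraph (Fin n)}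
    {W : ℕ → Matrix (Fin n) (Fin n) ℝ} {η : ℝ} {B : ℕ} (h : IsMixing G W η B) (hη : 0 < η) (t : ℕ) :
    W t ∈ doublyStochastic ℝ (Fin n) :=
  mem_doublyStochastic_iff_sum.2 ⟨h.nonneg hη t, h.row_sum t, h.col_sum t⟩

theorem IsMixing.mem_convexHull {Ω E : Type*} [NormedAddCommGroup E] [NormedSpace ℝ E] {n : ℕ}
    {G : ℕ → Digraph (Fin n)} {W : ℕ → Matrix (Fin n) (Fin n) ℝ} {η : ℝ} {B : ℕ}
    (h : IsMixing G W η B) (hη : 0 < η) {x v : Fin n → ℕ → Ω → E}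
    (hv : v = fun i t => mix (W t i) x t) (i : Fin n) (t : ℕ) (ω : Ω) :
    v i t ω ∈ convexHull ℝ (Set.range fun j => x j t ω) :=
  hv ▸ mix_mem_convexHull (h.nonneg hη t i) (h.row_sum t i) ω

/-! ### Stochastic mirror descent over one network -/

/-- Stochastic mirror descent of the agents of one network, reduced to what its regret analysis
needs: the costs and the other network enter only through the vectors `g i t ω`, of norm at most
`L`, of which `ghat i t ω` is an unbiased sample of variance at most `ν²` given `ℱ t`. -/
structure NetworkRun {Ω E : Type*} {mΩ : MeasurableSpace Ω} (P : Measure Ω)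
    [NormedAddCommGroup E] [NormedSpace ℝ E] [MeasurableSpace E] {n : ℕ}
    (X : Set E) (ψ : E → ℝ) (R : ℝ) (α : ℕ → ℝ) (L ν η : ℝ) (B : ℕ)
    (G : ℕ → Digraph (Fin n)) (W : ℕ → Matrix (Fin n) (Fin n) ℝ) (ℱ : Filtration ℕ mΩ)
    (v : Fin n → ℕ → Ω → E) (g ghat : Fin n → ℕ → Ω → StrongDual ℝ E)
    (x : Fin n → ℕ → Ω → E) : Prop where
  n_pos : 0 < n
  η_mem : 0 < η ∧ η < 1
  L_pos : 0 < L
  ν_pos : 0 < ν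
  step_nonneg : ∀ t, 0 ≤ α t
  step_antitone : Antitone α
  nonempty : X.Nonempty
  compact : IsCompact X
  regularizer : IsRegularizer X ψ
  diam : IsBregmanDiam X ψ R
  bregman_convex : ∀ z ∈ X, ConvexOn ℝ X (fun y => bregman ψ z y)
  mixing : IsMixing G W η B
  v_eq : v = fun i t => mix (W t i) x t
  init_mem : ∀ i ω, x i 0 ω ∈ X
  init_measurable : ∀ i, Measurable[ℱ 0] (x i 0)
  sampled_measurable : ∀ i t, StronglyMeasurable[ℱ (t + 1)] (ghat i t)
  update : ∀ i t ω, IsProx X ψ (v i t ω) (-(α t • ghat i t ω)) (x i (t + 1) ω)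
  norm_le : ∀ i t, ∀ᵐ ω ∂P, ‖g i t ω‖ ≤ L
  integrable : ∀ i t, Integrable (ghat i t) P
  unbiased : ∀ i t, P[ghat i t | ℱ t] =ᵐ[P] g i t
  sq_integrable : ∀ i t, Integrable (fun ω => ‖g i t ω - ghat i t ω‖ ^ 2) P
  variance_le : ∀ i t, P[fun ω => ‖g i t ω - ghat i t ω‖ ^ 2 | ℱ t] ≤ᵐ[P] fun _ => ν ^ 2

/-- The bound of `IsMixing.norm_sub_avg_le` for the distance of the estimates of a network to their
average, with the moves `x j (s + 1) ω - v j s ω` of the prox-steps as perturbations. -/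
noncomputable def disagreement {Ω E : Type*} [NormedAddCommGroup E] {n : ℕ} (η : ℝ) (B : ℕ)
    (x v : Fin n → ℕ → Ω → E) (t : ℕ) (ω : Ω) : ℝ :=
  Gam η n * theta η n B ^ t * ∑ j, ‖x j 0 ω‖
    + ∑ s ∈ Finset.range t, Gam η n * theta η n B ^ (t - 1 - s) *
        ∑ j, ‖x j (s + 1) ω - v j s ω‖

/-- The regret against `z` of the linearized costs `⟨g i t, ·⟩` at time `t`, averaged over the
agents. -/
noncomputable def linearizedRegret {Ω E : Type*} [NormedAddCommGroup E] [NormedSpace ℝ E] {n : ℕ}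
    (g : Fin n → ℕ → Ω → StrongDual ℝ E) (v : Fin n → ℕ → Ω → E) (z : E) (t : ℕ) (ω : Ω) : ℝ :=
  1 / (n : ℝ) * ∑ i, g i t ω (v i t ω - z)

namespace NetworkRun

variable {Ω E : Type*} {mΩ : MeasurableSpace Ω} {P : Measure Ω} [NormedAddCommGroup E]
  [NormedSpace ℝ E] [MeasurableSpace E] {n : ℕ} {X : Set E} {ψ : E → ℝ} {R : ℝ} {α : ℕ → ℝ}
  {L ν η : ℝ} {B : ℕ} {G : ℕ → Digraph (Fin n)} {W : ℕ → Matrix (Fin n) (Fin n) ℝ}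
  {ℱ : Filtration ℕ mΩ} {v : Fin n → ℕ → Ω → E} {g ghat : Fin n → ℕ → Ω → StrongDual ℝ E}
  {x : Fin n → ℕ → Ω → E}
  (h : NetworkRun P X ψ R α L ν η B G W ℱ v g ghat x)

include h

theorem convex : Convex ℝ X := h.regularizer.strongConvex.1

theorem mem (i : Fin n) (t : ℕ) (ω : Ω) : x i t ω ∈ X :=
  IsProx.mem_iterate (x := fun t => x i t ω) (h.init_mem i ω) (fun t => h.update i t ω) t

theorem v_mem_convexHull (i : Fin n) (t : ℕ) (ω : Ω) :
    v i t ω ∈ convexHull ℝ (Set.range fun j => x j t ω) :=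
  h.mixing.mem_convexHull h.η_mem.1 h.v_eq i t ω

theorem v_mem (i : Fin n) (t : ℕ) (ω : Ω) : v i t ω ∈ X :=
  mem_of_mem_convexHull_range h.convex (fun j => h.mem j t ω) (h.v_mem_convexHull i t ω)

theorem norm_sub_avg_le (i : Fin n) (t : ℕ) (ω : Ω) :
    ‖x i t ω - avg (fun j => x j t ω)‖ ≤ disagreement η B x v t ω :=
  h.mixing.norm_sub_avg_le (x := fun t i => x i t ω) (e := fun t i => x i (t + 1) ω - v i t ω)
    (fun t i => by rw [h.v_eq]; exact (add_sub_cancel _ _).symm) h.η_mem t i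

theorem norm_sub_avg_le_of_mem_convexHull {t : ℕ} {ω : Ω} {p : E}
    (hp : p ∈ convexHull ℝ (Set.range fun j => x j t ω)) :
    ‖p - avg (fun j => x j t ω)‖ ≤ disagreement η B x v t ω :=
  norm_sub_le_of_mem_convexHull hp (Set.forall_mem_range.2 fun j => h.norm_sub_avg_le j t ω)

theorem norm_step_le (i : Fin n) (t : ℕ) (ω : Ω) :
    ‖x i (t + 1) ω - v i t ω‖ ≤ α t * ‖ghat i t ω‖ := by
  refine ((h.update i t ω).norm_sub_le h.regularizer (h.v_mem i t ω)).trans_eq ?_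
  rw [norm_neg, norm_smul, Real.norm_of_nonneg (h.step_nonneg t)]

theorem sum_bregman_v_le {z : E} (hz : z ∈ X) (t : ℕ) (ω : Ω) :
    ∑ i, bregman ψ z (v i t ω) ≤ ∑ j, bregman ψ z (x j t ω) := by
  rw [h.v_eq]
  exact sum_map_sum_smul_le (h.bregman_convex z hz) (h.mixing.mem_doublyStochastic h.η_mem.1 t)
    fun j => h.mem j t ω

theorem step_mul_sum_apply_le {z : E} (hz : z ∈ X) (t : ℕ) (ω : Ω) :
    α t * ∑ i, ghat i t ω (v i t ω - z)
      ≤ ∑ j, bregman ψ z (x j t ω) - ∑ j, bregman ψ z (x j (t + 1) ω)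
        + α t ^ 2 / 2 * ∑ i, ‖ghat i t ω‖ ^ 2 := by
  have hprox : α t * ∑ i, ghat i t ω (v i t ω - z)
      ≤ ∑ i, bregman ψ z (v i t ω) - ∑ i, bregman ψ z (x i (t + 1) ω)
        + α t ^ 2 / 2 * ∑ i, ‖ghat i t ω‖ ^ 2 := by
    rw [Finset.mul_sum, Finset.mul_sum, ← Finset.sum_sub_distrib, ← Finset.sum_add_distrib]
    exact Finset.sum_le_sum fun i _ =>
      (h.update i t ω).mul_apply_sub_le h.regularizer (h.v_mem i t ω) hz
  linarith [h.sum_bregman_v_le hz t ω]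

theorem sum_step_mul_linearizedRegret_le {z : E} (hz : z ∈ X) (T : ℕ) (ω : Ω) :
    ∑ t ∈ Finset.range T, α t * linearizedRegret ghat v z t ω
      ≤ R ^ 2 + ∑ t ∈ Finset.range T, α t ^ 2 / 2 * (1 / (n : ℝ) * ∑ i, ‖ghat i t ω‖ ^ 2) := by
  set D : ℕ → ℝ := fun t => 1 / (n : ℝ) * ∑ j, bregman ψ z (x j t ω) with hD
  have hstep : ∀ t, α t * linearizedRegret ghat v z t ω
      ≤ D t - D (t + 1) + α t ^ 2 / 2 * (1 / (n : ℝ) * ∑ i, ‖ghat i t ω‖ ^ 2) := fun t => by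
    have := mul_le_mul_of_nonneg_left (h.step_mul_sum_apply_le hz t ω)
      (one_div_nonneg.2 n.cast_nonneg : (0 : ℝ) ≤ 1 / n)
    simp only [hD, linearizedRegret]
    linarith
  have hsum := Finset.sum_le_sum fun t (_ : t ∈ Finset.range T) => hstep t
  rw [Finset.sum_add_distrib, Finset.sum_range_sub'] at hsum
  have hD_zero : D 0 ≤ R ^ 2 :=
    one_div_mul_sum_le h.n_pos fun j => h.diam.2 ⟨z, hz, _, h.mem j 0 ω, rfl⟩
  have hD_nonneg : 0 ≤ D T := mul_nonneg (by positivity) <| Finset.sum_nonneg fun j _ =>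
    (by positivity : (0 : ℝ) ≤ 1 / 2 * ‖z - x j T ω‖ ^ 2).trans
      (h.regularizer.half_sq_le_bregman hz (h.mem j T ω))
  linarith

theorem integrable_gradient (i : Fin n) (t : ℕ) : Integrable (g i t) P :=
  integrable_condExp.congr (h.unbiased i t)

section Moments

theorem memLp_sampled [IsFiniteMeasure P] (i : Fin n) (t : ℕ) : MemLp (ghat i t) 2 P :=
  memLp_two_of_ae_norm_le h.ν_pos (h.norm_le i t) (h.integrable i t).aestronglyMeasurable
    (h.sq_integrable i t)

variable [IsProbabilityMeasure P]

theorem integral_norm_sq_sampled_le (i : Fin n) (t : ℕ) :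
    ∫ ω, ‖ghat i t ω‖ ^ 2 ∂P ≤ (L + ν) ^ 2 :=
  integral_norm_sq_le_of_ae_norm_le h.ν_pos h.L_pos.le (h.norm_le i t) (h.sq_integrable i t)
    (integral_le_of_condExp_le (ℱ.le t) (h.variance_le i t)) (h.memLp_sampled i t)

theorem integral_norm_sampled_le (i : Fin n) (t : ℕ) : ∫ ω, ‖ghat i t ω‖ ∂P ≤ L + ν :=
  integral_le_of_integral_sq_le (h.memLp_sampled i t).norm (add_pos h.L_pos h.ν_pos).le
    (h.integral_norm_sq_sampled_le i t)

end Moments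

section Measurability

variable [FiniteDimensional ℝ E] [BorelSpace E]

theorem measurable_state (t : ℕ) (i : Fin n) : Measurable[ℱ t] (x i t) := by
  induction t generalizing i with
  | zero => exact h.init_measurable i
  | succ t ih =>
    have hv : Measurable[ℱ (t + 1)] (v i t) := by
      rw [h.v_eq]
      exact measurable_mix (m := ℱ (t + 1)) fun j => (ih j).mono (ℱ.mono t.le_succ) le_rfl
    exact IsProx.measurable (m := ℱ (t + 1)) h.nonempty h.compact h.regularizer hv
      ((h.sampled_measurable i t).const_smul (α t)).neg (h.update i t)

theorem measurable_v (t : ℕ) (i : Fin n) : Measurable[ℱ t] (v i t) := by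
  rw [h.v_eq]
  exact measurable_mix (m := ℱ t) fun j => h.measurable_state t j

end Measurability

end NetworkRun

namespace NetworkRun

variable {Ω E : Type*} {mΩ : MeasurableSpace Ω} {P : Measure Ω} [NormedAddCommGroup E]
  [NormedSpace ℝ E] [FiniteDimensional ℝ E] [MeasurableSpace E] [BorelSpace E] {n : ℕ}
  {X : Set E} {ψ : E → ℝ} {R : ℝ} {α : ℕ → ℝ} {L ν η : ℝ} {B : ℕ} {G : ℕ → Digraph (Fin n)}
  {W : ℕ → Matrix (Fin n) (Fin n) ℝ} {ℱ : Filtration ℕ mΩ} {v : Fin n → ℕ → Ω → E}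
  {g ghat : Fin n → ℕ → Ω → StrongDual ℝ E} {x : Fin n → ℕ → Ω → E}
  (h : NetworkRun P X ψ R α L ν η B G W ℱ v g ghat x)

include h

theorem measurable (i : Fin n) (t : ℕ) : Measurable (x i t) :=
  (h.measurable_state t i).mono (ℱ.le t) le_rfl

theorem integrable_apply_v_sub {k : Ω → StrongDual ℝ E} (hk : Integrable k P) (i : Fin n) (t : ℕ)
    (z : E) : Integrable (fun ω => k ω (v i t ω - z)) P := by
  obtain ⟨C, hC⟩ := h.compact.isBounded.subset_closedBall z
  exact integrable_apply hk
    (((h.measurable_v t i).sub_const z).stronglyMeasurable.mono (ℱ.le t)).aestronglyMeasurable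
    fun ω => mem_closedBall_iff_norm.1 (hC (h.v_mem i t ω))

theorem integrable_linearizedRegret {k : Fin n → ℕ → Ω → StrongDual ℝ E} {t : ℕ}
    (hk : ∀ i, Integrable (k i t) P) (z : E) : Integrable (linearizedRegret k v z t) P :=
  (integrable_finsetSum _ fun i _ => h.integrable_apply_v_sub (hk i) i t z).const_mul _

theorem integrable_norm_step (i : Fin n) (t : ℕ) :
    Integrable (fun ω => ‖x i (t + 1) ω - v i t ω‖) P :=
  ((h.integrable i t).norm.const_mul (α t)).mono'
    ((h.measurable i (t + 1)).sub
      ((h.measurable_v t i).mono (ℱ.le t) le_rfl)).norm.aestronglyMeasurable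
    (ae_of_all _ fun ω => (norm_norm _).trans_le (h.norm_step_le i t ω))

theorem integrable_sum_norm_step (t : ℕ) :
    Integrable (fun ω => ∑ j, ‖x j (t + 1) ω - v j t ω‖) P :=
  integrable_finsetSum _ fun j _ => h.integrable_norm_step j t

section FiniteMeasure

variable [IsFiniteMeasure P]

theorem integrable_norm_sub_pow (i : Fin n) (t k : ℕ) (z : E) :
    Integrable (fun ω => ‖x i t ω - z‖ ^ k) P := by
  obtain ⟨C, hC⟩ := h.compact.isBounded.subset_closedBall z
  refine Integrable.of_bound (C := C ^ k)
    (((h.measurable i t).sub_const z).norm.pow_const k).aestronglyMeasurable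
    (ae_of_all _ fun ω => ?_)
  rw [norm_pow, norm_norm]
  exact pow_le_pow_left₀ (norm_nonneg _) (mem_closedBall_iff_norm.1 (hC (h.mem i t ω))) k

theorem integral_apply_sampled (i : Fin n) (t : ℕ) (z : E) :
    ∫ ω, ghat i t ω (v i t ω - z) ∂P = ∫ ω, g i t ω (v i t ω - z) ∂P := by
  obtain ⟨C, hC⟩ := h.compact.isBounded.subset_closedBall z
  exact integral_apply_eq_of_condExp (ℱ.le t) (h.integrable i t) (h.unbiased i t)
    ((h.measurable_v t i).sub_const z).stronglyMeasurable
    fun ω => mem_closedBall_iff_norm.1 (hC (h.v_mem i t ω))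

theorem integral_linearizedRegret_sampled (z : E) (t : ℕ) :
    ∫ ω, linearizedRegret ghat v z t ω ∂P = ∫ ω, linearizedRegret g v z t ω ∂P := by
  simp only [linearizedRegret, integral_const_mul]
  rw [integral_finsetSum _ fun i _ => h.integrable_apply_v_sub (h.integrable i t) i t z,
    integral_finsetSum _ fun i _ => h.integrable_apply_v_sub (h.integrable_gradient i t) i t z]
  simp only [h.integral_apply_sampled]

theorem integrable_sum_norm_init : Integrable (fun ω => ∑ j, ‖x j 0 ω‖) P :=
  integrable_finsetSum _ fun j _ => by simpa using h.integrable_norm_sub_pow j 0 1 0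

theorem integrable_disagreement (t : ℕ) : Integrable (disagreement η B x v t) P :=
  (h.integrable_sum_norm_init.const_mul _).add
    (integrable_finsetSum _ fun s _ => (h.integrable_sum_norm_step s).const_mul _)

theorem integral_sum_norm_init_le : ∫ ω, ∑ j, ‖x j 0 ω‖ ∂P ≤ n * Lam P x := by
  have hsup : Integrable (fun ω => ⨆ i, ‖x i 0 ω‖) P :=
    h.integrable_sum_norm_init.mono'
      (Measurable.iSup fun i => (h.measurable i 0).norm).aestronglyMeasurable
      (ae_of_all _ fun ω => by
        rw [Real.norm_of_nonneg (Real.iSup_nonneg fun i => norm_nonneg _)]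
        exact Real.iSup_le (fun i => Finset.single_le_sum (f := fun j => ‖x j 0 ω‖)
          (fun j _ => norm_nonneg _) (Finset.mem_univ i)) (by positivity))
  rw [Lam, ← integral_const_mul]
  refine integral_mono h.integrable_sum_norm_init (hsup.const_mul _) fun ω => ?_
  have := Finset.sum_le_card_nsmul Finset.univ (fun j => ‖x j 0 ω‖) _ fun j _ =>
    le_ciSup (Set.finite_range fun i => ‖x i 0 ω‖).bddAbove j
  simpa using this

end FiniteMeasure

section ProbabilityMeasure

variable [IsProbabilityMeasure P]

theorem sum_step_mul_integral_linearizedRegret_le {z : E} (hz : z ∈ X) (T : ℕ) :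
    ∑ t ∈ Finset.range T, α t * ∫ ω, linearizedRegret g v z t ω ∂P
      ≤ R ^ 2 + (L + ν) ^ 2 / 2 * ∑ t ∈ Finset.range T, α t ^ 2 := by
  have hsq : ∀ t, Integrable (fun ω => 1 / (n : ℝ) * ∑ i, ‖ghat i t ω‖ ^ 2) P := fun t =>
    (integrable_finsetSum _ fun i _ =>
      (h.memLp_sampled i t).integrable_norm_pow two_ne_zero).const_mul _
  have hsq_le : ∀ t, ∫ ω, 1 / (n : ℝ) * ∑ i, ‖ghat i t ω‖ ^ 2 ∂P ≤ (L + ν) ^ 2 := fun t => by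
    rw [integral_const_mul, integral_finsetSum _ fun i _ =>
      (h.memLp_sampled i t).integrable_norm_pow two_ne_zero]
    exact one_div_mul_sum_le h.n_pos fun i => h.integral_norm_sq_sampled_le i t
  have hregret : ∀ t, Integrable (linearizedRegret ghat v z t) P := fun t =>
    h.integrable_linearizedRegret (fun i => h.integrable i t) z
  have hsum := integrable_finsetSum (Finset.range T) fun t _ =>
    (hsq t).const_mul (α t ^ 2 / 2)
  calc ∑ t ∈ Finset.range T, α t * ∫ ω, linearizedRegret g v z t ω ∂P
      = ∫ ω, ∑ t ∈ Finset.range T, α t * linearizedRegret ghat v z t ω ∂P := by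
        rw [integral_finsetSum _ fun t _ => (hregret t).const_mul _]
        simp only [integral_const_mul, h.integral_linearizedRegret_sampled]
    _ ≤ ∫ ω, (R ^ 2 + ∑ t ∈ Finset.range T,
          α t ^ 2 / 2 * (1 / (n : ℝ) * ∑ i, ‖ghat i t ω‖ ^ 2)) ∂P :=
        integral_mono (integrable_finsetSum _ fun t _ => (hregret t).const_mul _)
          ((integrable_const _).add hsum) (h.sum_step_mul_linearizedRegret_le hz T)
    _ = R ^ 2 + ∑ t ∈ Finset.range T,
          α t ^ 2 / 2 * ∫ ω, 1 / (n : ℝ) * ∑ i, ‖ghat i t ω‖ ^ 2 ∂P := by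
        rw [integral_add (integrable_const _) hsum, integral_const, probReal_univ, one_smul,
          integral_finsetSum _ fun t _ => (hsq t).const_mul _]
        simp only [integral_const_mul]
    _ ≤ R ^ 2 + ∑ t ∈ Finset.range T, α t ^ 2 / 2 * (L + ν) ^ 2 := by
        gcongr with t _
        exact hsq_le t
    _ = _ := by rw [← Finset.sum_mul, ← Finset.sum_div]; ring

theorem integral_sum_norm_step_le (t : ℕ) :
    ∫ ω, ∑ j, ‖x j (t + 1) ω - v j t ω‖ ∂P ≤ n * ((L + ν) * α t) := by
  have hj : ∀ j, ∫ ω, ‖x j (t + 1) ω - v j t ω‖ ∂P ≤ (L + ν) * α t := fun j =>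
    calc ∫ ω, ‖x j (t + 1) ω - v j t ω‖ ∂P ≤ ∫ ω, α t * ‖ghat j t ω‖ ∂P :=
          integral_mono (h.integrable_norm_step j t) ((h.integrable j t).norm.const_mul _)
            (h.norm_step_le j t)
      _ = (∫ ω, ‖ghat j t ω‖ ∂P) * α t := by rw [integral_const_mul, mul_comm]
      _ ≤ (L + ν) * α t :=
          mul_le_mul_of_nonneg_right (h.integral_norm_sampled_le j t) (h.step_nonneg t)
  rw [integral_finsetSum _ fun j _ => h.integrable_norm_step j t]
  simpa using Finset.sum_le_card_nsmul Finset.univ _ _ fun j _ => hj j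

theorem integral_disagreement_le (t : ℕ) :
    ∫ ω, disagreement η B x v t ω ∂P
      ≤ n * Gam η n * Lam P x * theta η n B ^ t + n * Gam η n * (L + ν) *
        ∑ s ∈ Finset.range t, theta η n B ^ (t - 1 - s) * α s := by
  have hΓ := Gam_pos h.η_mem h.n_pos
  have hθ := theta_pos (B := B) h.η_mem h.n_pos
  have hstep := fun s => h.integrable_sum_norm_step s
  calc ∫ ω, disagreement η B x v t ω ∂P
      = Gam η n * theta η n B ^ t * ∫ ω, ∑ j, ‖x j 0 ω‖ ∂P
        + ∑ s ∈ Finset.range t, Gam η n * theta η n B ^ (t - 1 - s) *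
          ∫ ω, ∑ j, ‖x j (s + 1) ω - v j s ω‖ ∂P := by
        unfold disagreement
        rw [integral_add (h.integrable_sum_norm_init.const_mul _)
          (integrable_finsetSum _ fun s _ => (hstep s).const_mul _),
          integral_finsetSum _ fun s _ => (hstep s).const_mul _]
        simp only [integral_const_mul]
    _ ≤ Gam η n * theta η n B ^ t * (n * Lam P x)
        + ∑ s ∈ Finset.range t, Gam η n * theta η n B ^ (t - 1 - s) * (n * ((L + ν) * α s)) := by
        gcongr with s _
        · exact h.integral_sum_norm_init_le
        · exact h.integral_sum_norm_step_le s
    _ = _ := by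
        rw [Finset.mul_sum]
        congr 1
        · ring
        · exact Finset.sum_congr rfl fun s _ => by ring

theorem step_mul_integral_disagreement_le (t : ℕ) :
    α t * ∫ ω, disagreement η B x v t ω ∂P
      ≤ n * Gam η n * Lam P x * α 0 * theta η n B ^ t + n * Gam η n * (L + ν) *
        ∑ s ∈ Finset.range t, theta η n B ^ (t - 1 - s) * α s ^ 2 := by
  have hΓ := Gam_pos h.η_mem h.n_pos
  have hθ := theta_pos (B := B) h.η_mem h.n_pos
  have hLν : 0 < L + ν := add_pos h.L_pos h.ν_pos
  have hΛ : 0 ≤ Lam P x := integral_nonneg fun ω => Real.iSup_nonneg fun i => norm_nonneg _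
  have hpast : α t * ∑ s ∈ Finset.range t, theta η n B ^ (t - 1 - s) * α s
      ≤ ∑ s ∈ Finset.range t, theta η n B ^ (t - 1 - s) * α s ^ 2 := by
    rw [Finset.mul_sum]
    refine Finset.sum_le_sum fun s hs => ?_
    have := mul_le_mul_of_nonneg_right (h.step_antitone (Finset.mem_range.1 hs).le)
      (mul_nonneg (pow_nonneg hθ.le (t - 1 - s)) (h.step_nonneg s))
    linarith
  have hinit := h.step_antitone (Nat.zero_le t)
  calc α t * ∫ ω, disagreement η B x v t ω ∂P
      ≤ α t * (n * Gam η n * Lam P x * theta η n B ^ t + n * Gam η n * (L + ν) *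
        ∑ s ∈ Finset.range t, theta η n B ^ (t - 1 - s) * α s) :=
        mul_le_mul_of_nonneg_left (h.integral_disagreement_le t) (h.step_nonneg t)
    _ = n * Gam η n * Lam P x * α t * theta η n B ^ t + n * Gam η n * (L + ν) *
        (α t * ∑ s ∈ Finset.range t, theta η n B ^ (t - 1 - s) * α s) := by ring
    _ ≤ _ := by gcongr

theorem sum_step_mul_integral_disagreement_le (T : ℕ) :
    ∑ t ∈ Finset.range T, α t * ∫ ω, disagreement η B x v t ω ∂P
      ≤ n * Gam η n * Lam P x * α 0 / (1 - theta η n B)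
        + n * Gam η n * (L + ν) / (1 - theta η n B) * ∑ t ∈ Finset.range T, α t ^ 2 := by
  have hΓ := Gam_pos h.η_mem h.n_pos
  have hθ₀ := (theta_pos (B := B) h.η_mem h.n_pos).le
  have hθ₁ := theta_lt_one h.η_mem h.n_pos h.mixing.one_le_window
  have hLν : 0 < L + ν := add_pos h.L_pos h.ν_pos
  have hα := h.step_nonneg 0
  have hΛ : 0 ≤ Lam P x := integral_nonneg fun ω => Real.iSup_nonneg fun i => norm_nonneg _
  calc ∑ t ∈ Finset.range T, α t * ∫ ω, disagreement η B x v t ω ∂P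
      ≤ n * Gam η n * Lam P x * α 0 * ∑ t ∈ Finset.range T, theta η n B ^ t
        + n * Gam η n * (L + ν) * ∑ t ∈ Finset.range T,
          ∑ s ∈ Finset.range t, theta η n B ^ (t - 1 - s) * α s ^ 2 := by
        rw [Finset.mul_sum, Finset.mul_sum, ← Finset.sum_add_distrib]
        exact Finset.sum_le_sum fun t _ => h.step_mul_integral_disagreement_le t
    _ ≤ n * Gam η n * Lam P x * α 0 * (1 / (1 - theta η n B))
        + n * Gam η n * (L + ν) * ((∑ t ∈ Finset.range T, α t ^ 2) / (1 - theta η n B)) := by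
        gcongr
        · exact geom_sum_le_one_div hθ₀ hθ₁ T
        · exact sum_sum_geom_le hθ₀ hθ₁ (fun t => sq_nonneg _) T
    _ = _ := by ring

end ProbabilityMeasure

end NetworkRun

/-! ### Nash equilibria -/

section Nash

variable {E₁ E₂ : Type*} [NormedAddCommGroup E₁] [NormedSpace ℝ E₁] [NormedAddCommGroup E₂]
  [NormedSpace ℝ E₂] {X₁ : Set E₁} {X₂ : Set E₂} {U : E₁ → E₂ → ℝ} {μ : ℝ}

theorem IsNash.mul_sq_dist_le_gap (hU : IsStronglyConvexConcave X₁ X₂ μ U) {y₁ z₁ : E₁}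
    {y₂ z₂ : E₂} (h : IsNash X₁ X₂ U y₁ y₂) (hz₁ : z₁ ∈ X₁) (hz₂ : z₂ ∈ X₂) :
    μ / 2 * (‖z₁ - y₁‖ ^ 2 + ‖z₂ - y₂‖ ^ 2) ≤ U z₁ y₂ - U y₁ z₂ := by
  obtain ⟨hy₁, hy₂, hsaddle⟩ := h
  have hgrowth₁ := add_sq_le_of_strongConvexOn (hU.1 y₂ hy₂) hy₁
    (fun x hx => (hsaddle x hx y₂ hy₂).2) hz₁
  have hgrowth₂ := add_sq_le_of_strongConvexOn (UniformConcaveOn.neg (hU.2 y₁ hy₁)) hy₂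
    (fun x hx => neg_le_neg (hsaddle y₁ hy₁ x hx).1) hz₂
  simp only [Pi.neg_apply] at hgrowth₂
  linarith

theorem IsNash.unique (hμ : 0 < μ) (hU : IsStronglyConvexConcave X₁ X₂ μ U) {y z : E₁ × E₂}
    (hy : IsNash X₁ X₂ U y.1 y.2) (hz : IsNash X₁ X₂ U z.1 z.2) : z = y := by
  have hgap := hy.mul_sq_dist_le_gap hU hz.1 hz.2.1
  have hsaddle := hz.2.2 y.1 hy.1 y.2 hy.2.1
  have hdist : ‖z.1 - y.1‖ ^ 2 + ‖z.2 - y.2‖ ^ 2 ≤ 0 :=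
    nonpos_of_mul_nonpos_right (hgap.trans (by linarith)) (half_pos hμ)
  have hzero := (add_eq_zero_iff_of_nonneg (sq_nonneg _) (sq_nonneg _)).1
    (hdist.antisymm (by positivity))
  simpa [Prod.ext_iff, sub_eq_zero] using hzero

theorem exists_isNash (hX₁ : X₁.Nonempty) (hX₁c : IsCompact X₁) (hX₂ : X₂.Nonempty)
    (hX₂c : IsCompact X₂) (hU₁ : ∀ y ∈ X₂, LowerSemicontinuousOn (fun x => U x y) X₁)
    (hU₂ : ∀ x ∈ X₁, UpperSemicontinuousOn (fun y => U x y) X₂) (hμ : 0 ≤ μ)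
    (hU : IsStronglyConvexConcave X₁ X₂ μ U) : ∃ y₁ y₂, IsNash X₁ X₂ U y₁ y₂ := by
  obtain ⟨x₁, hx₁⟩ := hX₁
  obtain ⟨x₂, hx₂⟩ := hX₂
  obtain ⟨y₁, hy₁, y₂, hy₂, hsaddle⟩ := Sion.exists_isSaddlePointOn (f := U) ⟨x₁, hx₁⟩
    (hU.1 x₂ hx₂).1 hX₁c hU₁
    (fun y hy => (UniformConvexOn.convexOn (hU.1 y hy) fun _ => by positivity).quasiconvexOn)
    (hU.2 x₁ hx₁).1 ⟨x₂, hx₂⟩ hX₂c hU₂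
    (fun x hx => (UniformConcaveOn.concaveOn (hU.2 x hx) fun _ => by positivity).quasiconcaveOn)
  exact ⟨y₁, y₂, hy₁, hy₂, fun x hx y hy => ⟨hsaddle y₁ hy₁ y hy, hsaddle x hx y₂ hy₂⟩⟩

theorem existsUnique_isNash (hX₁ : X₁.Nonempty) (hX₁c : IsCompact X₁) (hX₂ : X₂.Nonempty)
    (hX₂c : IsCompact X₂) (hU₁ : ∀ y ∈ X₂, LowerSemicontinuousOn (fun x => U x y) X₁)
    (hU₂ : ∀ x ∈ X₁, UpperSemicontinuousOn (fun y => U x y) X₂) (hμ : 0 < μ)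
    (hU : IsStronglyConvexConcave X₁ X₂ μ U) : ∃! y : E₁ × E₂, IsNash X₁ X₂ U y.1 y.2 :=
  have ⟨y₁, y₂, hy⟩ := exists_isNash hX₁ hX₁c hX₂ hX₂c hU₁ hU₂ hμ.le hU
  ⟨(y₁, y₂), hy, fun _ hz => IsNash.unique hμ hU hy hz⟩

end Nash

/-! ### Costs -/

section Costs

variable {E F : Type*} [NormedAddCommGroup E] [NormedAddCommGroup F] {X : Set E} {Y : Set F}
  {L : ℝ}

theorem IsLipschitzCost.continuousOn_left {f : E → F → ℝ} (hf : IsLipschitzCost X Y L f) {y : F}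
    (hy : y ∈ Y) : ContinuousOn (fun x => f x y) X :=
  (LipschitzOnWith.of_dist_le' fun x hx x' hx' => by
    simpa [Real.dist_eq, dist_eq_norm] using hf x hx x' hx' y hy y hy).continuousOn

theorem IsLipschitzCost.continuousOn_right {f : E → F → ℝ} (hf : IsLipschitzCost X Y L f) {x : E}
    (hx : x ∈ X) : ContinuousOn (fun y => f x y) Y :=
  (LipschitzOnWith.of_dist_le' fun y hy y' hy' => by
    simpa [Real.dist_eq, dist_eq_norm] using hf x hx x hx y hy y' hy').continuousOn

theorem IsLipschitzCost.mono_left {O : Set E} {f : E → F → ℝ} (hf : IsLipschitzCost O Y L f)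
    (hXO : X ⊆ O) : IsLipschitzCost X Y L f :=
  fun x hx x' hx' => hf x (hXO hx) x' (hXO hx')

theorem IsLipschitzCost.of_eq_one_div_mul_sum {n : ℕ} (hn : 0 < n) {f : Fin n → E → F → ℝ}
    (hf : ∀ i, IsLipschitzCost X Y L (f i)) {U : E → F → ℝ}
    (hU : ∀ x ∈ X, ∀ y ∈ Y, U x y = 1 / (n : ℝ) * ∑ i, f i x y) : IsLipschitzCost X Y L U := by
  intro x hx x' hx' y hy y' hy'
  rw [hU x hx y hy, hU x' hx' y' hy', ← mul_sub, ← Finset.sum_sub_distrib, abs_mul,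
    abs_of_nonneg (by positivity)]
  exact (mul_le_mul_of_nonneg_left (Finset.abs_sum_le_sum_abs _ _) (by positivity)).trans
    (one_div_mul_sum_le hn fun i => hf i x hx x' hx' y hy y' hy')

theorem IsLipschitzCost.gap_le_add {U : E → F → ℝ} (hU : IsLipschitzCost X Y L U) (hL : 0 ≤ L)
    {x c z : E} {y d w : F} (hx : x ∈ X) (hc : c ∈ X) (hz : z ∈ X) (hy : y ∈ Y) (hd : d ∈ Y)
    (hw : w ∈ Y) {a b : ℝ} (ha : ‖x - c‖ ≤ a) (hb : ‖y - d‖ ≤ b) :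
    U x w - U z y ≤ U c w - U z d + L * (a + b) := by
  have hmove := (abs_le.1 (hU x hx c hc w hw w hw)).2
  have hmove' := (abs_le.1 (hU z hz z hz y hy d hd)).1
  rw [sub_self, norm_zero, add_zero] at hmove
  rw [sub_self, norm_zero, zero_add] at hmove'
  have hsum := mul_le_mul_of_nonneg_left (add_le_add ha hb) hL
  linarith

variable [NormedSpace ℝ E]

theorem subdiff_anti {O : Set E} (hXO : X ⊆ O) (f : E → ℝ) (x : E) :
    subdiff O f x ⊆ subdiff X f x := fun _ hg y hy => hg y (hXO hy)

theorem IsLipschitzCost.norm_le_of_mem_subdiff {f : E → F → ℝ} (hf : IsLipschitzCost X Y L f)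
    (hX : IsOpen X) (hL : 0 ≤ L) {p : E} {q : F} (hp : p ∈ X) (hq : q ∈ Y) {k : StrongDual ℝ E}
    (hk : k ∈ subdiff X (fun z => f z q) p) : ‖k‖ ≤ L := by
  refine DSMD.norm_le_of_mem_subdiff hX hp hL (fun z hz => ?_) hk
  simpa using (abs_le.1 (hf z hz p hp q hq q hq)).2

theorem IsLipschitzCost.sub_le_apply_of_mem_subdiff {f : E → F → ℝ} (hf : IsLipschitzCost X Y L f)
    (hL : 0 ≤ L) {v c z : E} {u d : F} (hv : v ∈ X) (hu : u ∈ Y) (hc : c ∈ X) (hz : z ∈ X)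
    (hd : d ∈ Y) {g : StrongDual ℝ E} (hg : g ∈ subdiff X (fun x => f x u) v) {a b : ℝ}
    (ha : ‖v - c‖ ≤ a) (hb : ‖u - d‖ ≤ b) :
    f c d - f z d - (L * a + 2 * (L * b)) ≤ g (v - z) := by
  have hsub : f v u + g (z - v) ≤ f z u := hg z hz
  have hmove := (abs_le.1 (hf v hv c hc u hu d hd)).1
  have hmove_z := (abs_le.1 (hf z hz z hz u hu d hd)).2
  rw [sub_self, norm_zero, zero_add] at hmove_z
  have hLa := mul_le_mul_of_nonneg_left ha hL
  have hLb := mul_le_mul_of_nonneg_left hb hL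
  rw [← neg_sub z v, map_neg]
  linarith

theorem one_div_mul_sum_sub_le_of_mem_subdiff {n : ℕ} (hn : 0 < n) {f : Fin n → E → F → ℝ}
    (hf : ∀ i, IsLipschitzCost X Y L (f i)) (hL : 0 ≤ L) {v : Fin n → E} {c z : E} {u : Fin n → F}
    {d : F} (hv : ∀ i, v i ∈ X) (hu : ∀ i, u i ∈ Y) (hc : c ∈ X) (hz : z ∈ X) (hd : d ∈ Y)
    {g : Fin n → StrongDual ℝ E} (hg : ∀ i, g i ∈ subdiff X (fun x => f i x (u i)) (v i))
    {a b : ℝ} (ha : ∀ i, ‖v i - c‖ ≤ a) (hb : ∀ i, ‖u i - d‖ ≤ b) :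
    1 / (n : ℝ) * ∑ i, f i c d - 1 / (n : ℝ) * ∑ i, f i z d - (L * a + 2 * (L * b))
      ≤ 1 / (n : ℝ) * ∑ i, g i (v i - z) := by
  have hagent : ∀ i, f i c d - f i z d - g i (v i - z) ≤ L * a + 2 * (L * b) := fun i => by
    linarith [(hf i).sub_le_apply_of_mem_subdiff hL (hv i) (hu i) hc hz hd (hg i) (ha i) (hb i)]
  have := one_div_mul_sum_le hn hagent
  rw [Finset.sum_sub_distrib, Finset.sum_sub_distrib, mul_sub, mul_sub] at this
  linarith

end Costs

/-! ### Time averages -/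

section TimeAvg

variable {Ω E : Type*} [NormedAddCommGroup E] [NormedSpace ℝ E] {α : ℕ → ℝ} {x : ℕ → Ω → E} {t : ℕ}

theorem norm_timeAvg_sub_sq_le (hα : ∀ t, 0 ≤ α t) (ht : 0 < ∑ s ∈ Finset.range t, α s) (y : E)
    (ω : Ω) : ‖timeAvg α x t ω - y‖ ^ 2
      ≤ (∑ s ∈ Finset.range t, α s)⁻¹ * ∑ s ∈ Finset.range t, α s * ‖x s ω - y‖ ^ 2 := by
  have hconvex : ConvexOn ℝ Set.univ (fun z : E => ‖z - y‖ ^ 2) := by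
    simpa only [dist_eq_norm, Pi.pow_def] using
      (convexOn_univ_dist y).pow (fun _ _ => dist_nonneg) 2
  have := hconvex.map_centerMass_le (fun s _ => hα s) ht (fun s _ => Set.mem_univ (x s ω))
  simpa only [Finset.centerMass, smul_eq_mul, Function.comp_apply, timeAvg] using this

theorem measurable_timeAvg [MeasurableSpace Ω] [FiniteDimensional ℝ E] [MeasurableSpace E]
    [BorelSpace E] (hx : ∀ t, Measurable (x t)) : Measurable (timeAvg α x t) := by
  have : ProperSpace E := FiniteDimensional.proper_real E
  exact (Finset.measurable_fun_sum _ fun s _ => (hx s).const_smul (α s)).const_smul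
    (∑ s ∈ Finset.range t, α s)⁻¹

variable {F : Type*} [NormedAddCommGroup F] [NormedSpace ℝ F] {y : ℕ → Ω → F}

theorem sqError_nonneg (α : ℕ → ℝ) (x : ℕ → Ω → E) (y : ℕ → Ω → F) (z : E) (w : F) (t : ℕ)
    (ω : Ω) : 0 ≤ sqError α x y z w t ω := add_nonneg (sq_nonneg _) (sq_nonneg _)

theorem sqError_le (hα : ∀ t, 0 ≤ α t) (ht : 0 < ∑ s ∈ Finset.range t, α s) (z : E) (w : F)
    (ω : Ω) : sqError α x y z w t ω ≤ (∑ s ∈ Finset.range t, α s)⁻¹ *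
      ∑ s ∈ Finset.range t, α s * (‖x s ω - z‖ ^ 2 + ‖y s ω - w‖ ^ 2) := by
  simp only [mul_add, Finset.sum_add_distrib]
  exact add_le_add (norm_timeAvg_sub_sq_le hα ht z ω) (norm_timeAvg_sub_sq_le hα ht w ω)

end TimeAvg

/-! ### Two networks -/

theorem M2part_nonneg {L ν η : ℝ} {n B : ℕ} (hL : 0 ≤ L) (hν : 0 ≤ ν) (hη : 0 < η ∧ η < 1)
    (hn : 0 < n) (hB : 1 ≤ B) : 0 ≤ M2part L ν η n B := by
  have hΓ := Gam_pos hη hn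
  have hθ : 0 < 1 - theta η n B := sub_pos.2 (theta_lt_one hη hn hB)
  unfold M2part
  positivity

theorem regret_add_disagreement_le {L ν η R Λ a Q : ℝ} {n B : ℕ} (hL : 0 ≤ L) (hν : 0 ≤ ν)
    (hQ : 0 ≤ Q) :
    R ^ 2 + (L + ν) ^ 2 / 2 * Q + 4 * L * (n * Gam η n * Λ * a / (1 - theta η n B)
        + n * Gam η n * (L + ν) / (1 - theta η n B) * Q)
      ≤ M1part L η n B Λ a R + M2part L ν η n B * Q := by
  have hslack : 0 ≤ R ^ 2 + (8 * L * (L + ν) + (L + ν) ^ 2 / 2 + ν ^ 2 / 2) * Q := by positivity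
  refine (le_add_of_nonneg_right hslack).trans_eq ?_
  unfold M1part M2part
  ring

namespace NetworkRun

variable {Ω E : Type*} {mΩ : MeasurableSpace Ω} {P : Measure Ω} [NormedAddCommGroup E]
  [NormedSpace ℝ E] [MeasurableSpace E] {n : ℕ} {X : Set E} {ψ : E → ℝ} {R : ℝ} {α : ℕ → ℝ}
  {L ν η : ℝ} {B : ℕ} {G : ℕ → Digraph (Fin n)} {W : ℕ → Matrix (Fin n) (Fin n) ℝ}
  {ℱ : Filtration ℕ mΩ} {v : Fin n → ℕ → Ω → E} {g ghat : Fin n → ℕ → Ω → StrongDual ℝ E}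
  {x : Fin n → ℕ → Ω → E}
  (h : NetworkRun P X ψ R α L ν η B G W ℱ v g ghat x)

include h

theorem avg_mem (t : ℕ) (ω : Ω) : avg (fun j => x j t ω) ∈ X :=
  DSMD.avg_mem h.convex h.n_pos fun j => h.mem j t ω

theorem sub_le_linearizedRegret {F : Type*} [NormedAddCommGroup F] {Y : Set F}
    {f : Fin n → E → F → ℝ} (hf : ∀ i, IsLipschitzCost X Y L (f i)) {u : Fin n → F} {t : ℕ} {ω : Ω}
    (hg : ∀ i, g i t ω ∈ subdiff X (fun y => f i y (u i)) (v i t ω)) (hu : ∀ i, u i ∈ Y) {d : F}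
    (hd : d ∈ Y) {b : ℝ} (hb : ∀ i, ‖u i - d‖ ≤ b) {z : E} (hz : z ∈ X) :
    1 / (n : ℝ) * ∑ i, f i (avg fun j => x j t ω) d - 1 / (n : ℝ) * ∑ i, f i z d
        - (L * disagreement η B x v t ω + 2 * (L * b)) ≤ linearizedRegret g v z t ω :=
  one_div_mul_sum_sub_le_of_mem_subdiff h.n_pos hf h.L_pos.le (fun i => h.v_mem i t ω) hu
    (h.avg_mem t ω) hz hd hg
    (fun i => h.norm_sub_avg_le_of_mem_convexHull (h.v_mem_convexHull i t ω)) hb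

theorem sum_step_mul_integral_regret_add_disagreement_le [IsProbabilityMeasure P]
    [FiniteDimensional ℝ E] [BorelSpace E] {z : E} (hz : z ∈ X) (T : ℕ) :
    ∑ t ∈ Finset.range T, α t * ∫ ω, linearizedRegret g v z t ω ∂P
        + 4 * L * ∑ t ∈ Finset.range T, α t * ∫ ω, disagreement η B x v t ω ∂P
      ≤ M1part L η n B (Lam P x) (α 0) R
        + M2part L ν η n B * ∑ t ∈ Finset.range T, α t ^ 2 :=
  (add_le_add (h.sum_step_mul_integral_linearizedRegret_le hz T)
    (mul_le_mul_of_nonneg_left (h.sum_step_mul_integral_disagreement_le T)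
      (mul_pos four_pos h.L_pos).le)).trans
    (regret_add_disagreement_le h.L_pos.le h.ν_pos.le (Finset.sum_nonneg fun _ _ => sq_nonneg _))

end NetworkRun

section TwoNetworks

variable {Ω : Type*} {mΩ : MeasurableSpace Ω} {P : Measure Ω}
  {E₁ : Type*} [NormedAddCommGroup E₁] [NormedSpace ℝ E₁] [MeasurableSpace E₁]
  {E₂ : Type*} [NormedAddCommGroup E₂] [NormedSpace ℝ E₂] [MeasurableSpace E₂]
  {X₁ : Set E₁} {X₂ : Set E₂} {ψ₁ : E₁ → ℝ} {ψ₂ : E₂ → ℝ} {R₁ R₂ : ℝ} {α : ℕ → ℝ}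
  {n₁ n₂ : ℕ} {f₁ : Fin n₁ → E₁ → E₂ → ℝ} {f₂ : Fin n₂ → E₂ → E₁ → ℝ} {L ν₁ ν₂ η : ℝ}
  {B₁ B₂ : ℕ} {G₁ : ℕ → Digraph (Fin n₁)} {W₁ : ℕ → Matrix (Fin n₁) (Fin n₁) ℝ}
  {G₂ : ℕ → Digraph (Fin n₂)} {W₂ : ℕ → Matrix (Fin n₂) (Fin n₂) ℝ} {ℱ : Filtration ℕ mΩ}
  {x₁ v₁ : Fin n₁ → ℕ → Ω → E₁} {u₂ : Fin n₁ → ℕ → Ω → E₂}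
  {x₂ v₂ : Fin n₂ → ℕ → Ω → E₂} {u₁ : Fin n₂ → ℕ → Ω → E₁}
  {g₁ ghat₁ : Fin n₁ → ℕ → Ω → StrongDual ℝ E₁} {g₂ ghat₂ : Fin n₂ → ℕ → Ω → StrongDual ℝ E₂}
  {U : E₁ → E₂ → ℝ} {μ : ℝ} {y₁ : E₁} {y₂ : E₂}
  (h₁ : NetworkRun P X₁ ψ₁ R₁ α L ν₁ η B₁ G₁ W₁ ℱ v₁ g₁ ghat₁ x₁)
  (h₂ : NetworkRun P X₂ ψ₂ R₂ α L ν₂ η B₂ G₂ W₂ ℱ v₂ g₂ ghat₂ x₂)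

include h₁ h₂

section TimeAvg

variable [IsFiniteMeasure P] [FiniteDimensional ℝ E₁] [BorelSpace E₁] [FiniteDimensional ℝ E₂]
  [BorelSpace E₂]

theorem integrable_step_mul_sq_dist (i : Fin n₁) (j : Fin n₂) (t : ℕ) (z₁ : E₁) (z₂ : E₂) :
    Integrable (fun ω => α t * (‖x₁ i t ω - z₁‖ ^ 2 + ‖x₂ j t ω - z₂‖ ^ 2)) P :=
  ((h₁.integrable_norm_sub_pow i t 2 z₁).add (h₂.integrable_norm_sub_pow j t 2 z₂)).const_mul _

theorem integrable_sqError (i : Fin n₁) (j : Fin n₂) {t : ℕ}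
    (ht : 0 < ∑ s ∈ Finset.range t, α s) (z₁ : E₁) (z₂ : E₂) :
    Integrable (sqError α (x₁ i) (x₂ j) z₁ z₂ t) P := by
  have hmeas₁ := measurable_timeAvg (α := α) (t := t) (h₁.measurable i)
  have hmeas₂ := measurable_timeAvg (α := α) (t := t) (h₂.measurable j)
  refine ((integrable_finsetSum (Finset.range t) fun s _ =>
    integrable_step_mul_sq_dist h₁ h₂ i j s z₁ z₂).const_mul (∑ s ∈ Finset.range t, α s)⁻¹).mono'
    (((hmeas₁.sub_const z₁).norm.pow_const 2).add
      ((hmeas₂.sub_const z₂).norm.pow_const 2)).aestronglyMeasurable (ae_of_all _ fun ω => ?_)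
  rw [Real.norm_of_nonneg (sqError_nonneg α _ _ z₁ z₂ t ω)]
  exact sqError_le h₁.step_nonneg ht z₁ z₂ ω

theorem integral_sqError_le (i : Fin n₁) (j : Fin n₂) {t : ℕ}
    (ht : 0 < ∑ s ∈ Finset.range t, α s) (z₁ : E₁) (z₂ : E₂) :
    ∫ ω, sqError α (x₁ i) (x₂ j) z₁ z₂ t ω ∂P ≤ (∑ s ∈ Finset.range t, α s)⁻¹ *
      ∑ s ∈ Finset.range t, α s * ∫ ω, (‖x₁ i s ω - z₁‖ ^ 2 + ‖x₂ j s ω - z₂‖ ^ 2) ∂P := by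
  have hint := fun s => integrable_step_mul_sq_dist h₁ h₂ i j s z₁ z₂
  refine (integral_mono (integrable_sqError h₁ h₂ i j ht z₁ z₂)
    ((integrable_finsetSum (Finset.range t) fun s _ => hint s).const_mul _)
    (sqError_le h₁.step_nonneg ht z₁ z₂)).trans_eq ?_
  rw [integral_const_mul, integral_finsetSum _ fun s _ => hint s]
  simp only [integral_const_mul]

end TimeAvg

section Regret

variable (hf₁ : ∀ i, IsLipschitzCost X₁ X₂ L (f₁ i)) (hf₂ : ∀ j, IsLipschitzCost X₂ X₁ L (f₂ j))
  (hU₁ : ∀ x₁ ∈ X₁, ∀ x₂ ∈ X₂, U x₁ x₂ = 1 / (n₁ : ℝ) * ∑ i, f₁ i x₁ x₂)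
  (hU₂ : ∀ x₁ ∈ X₁, ∀ x₂ ∈ X₂, U x₁ x₂ = -(1 / (n₂ : ℝ) * ∑ j, f₂ j x₂ x₁))
  (hu₂ : ∀ i t ω, u₂ i t ω ∈ convexHull ℝ (Set.range fun j => x₂ j t ω))
  (hu₁ : ∀ j t ω, u₁ j t ω ∈ convexHull ℝ (Set.range fun i => x₁ i t ω))

include hf₁ hf₂ hU₁ hU₂ hu₁ hu₂

theorem gap_avg_le_linearizedRegret (hy₁ : y₁ ∈ X₁) (hy₂ : y₂ ∈ X₂) {t : ℕ} {ω : Ω}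
    (hg₁ : ∀ i, g₁ i t ω ∈ subdiff X₁ (fun y => f₁ i y (u₂ i t ω)) (v₁ i t ω))
    (hg₂ : ∀ j, g₂ j t ω ∈ subdiff X₂ (fun y => f₂ j y (u₁ j t ω)) (v₂ j t ω)) :
    U (avg fun i => x₁ i t ω) y₂ - U y₁ (avg fun j => x₂ j t ω)
      ≤ linearizedRegret g₁ v₁ y₁ t ω + linearizedRegret g₂ v₂ y₂ t ω
        + 3 * L * (disagreement η B₁ x₁ v₁ t ω + disagreement η B₂ x₂ v₂ t ω) := by
  have hc₁ := h₁.avg_mem t ω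
  have hc₂ := h₂.avg_mem t ω
  have hregret₁ := h₁.sub_le_linearizedRegret hf₁ hg₁
    (fun i => mem_of_mem_convexHull_range h₂.convex (fun j => h₂.mem j t ω) (hu₂ i t ω)) hc₂
    (fun i => h₂.norm_sub_avg_le_of_mem_convexHull (hu₂ i t ω)) hy₁
  have hregret₂ := h₂.sub_le_linearizedRegret hf₂ hg₂
    (fun j => mem_of_mem_convexHull_range h₁.convex (fun i => h₁.mem i t ω) (hu₁ j t ω)) hc₁
    (fun j => h₁.norm_sub_avg_le_of_mem_convexHull (hu₁ j t ω)) hy₂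
  rw [← hU₁ _ hc₁ _ hc₂, ← hU₁ _ hy₁ _ hc₂] at hregret₁
  linarith [hU₂ _ hc₁ _ hc₂, hU₂ _ hc₁ _ hy₂]

theorem IsNash.mul_sq_dist_le_linearizedRegret (hU : IsStronglyConvexConcave X₁ X₂ μ U)
    (hy : IsNash X₁ X₂ U y₁ y₂) (i : Fin n₁) (j : Fin n₂) {t : ℕ} {ω : Ω}
    (hg₁ : ∀ i, g₁ i t ω ∈ subdiff X₁ (fun y => f₁ i y (u₂ i t ω)) (v₁ i t ω))
    (hg₂ : ∀ j, g₂ j t ω ∈ subdiff X₂ (fun y => f₂ j y (u₁ j t ω)) (v₂ j t ω)) :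
    μ / 2 * (‖x₁ i t ω - y₁‖ ^ 2 + ‖x₂ j t ω - y₂‖ ^ 2)
      ≤ linearizedRegret g₁ v₁ y₁ t ω + linearizedRegret g₂ v₂ y₂ t ω
        + 4 * L * (disagreement η B₁ x₁ v₁ t ω + disagreement η B₂ x₂ v₂ t ω) := by
  have hgrowth := hy.mul_sq_dist_le_gap hU (h₁.mem i t ω) (h₂.mem j t ω)
  have hmove := (IsLipschitzCost.of_eq_one_div_mul_sum h₁.n_pos hf₁ hU₁).gap_le_add h₁.L_pos.le
    (h₁.mem i t ω) (h₁.avg_mem t ω) hy.1 (h₂.mem j t ω) (h₂.avg_mem t ω) hy.2.1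
    (h₁.norm_sub_avg_le i t ω) (h₂.norm_sub_avg_le j t ω)
  have hregret := gap_avg_le_linearizedRegret h₁ h₂ hf₁ hf₂ hU₁ hU₂ hu₂ hu₁ hy.1 hy.2.1 hg₁ hg₂
  linarith

variable [FiniteDimensional ℝ E₁] [BorelSpace E₁] [FiniteDimensional ℝ E₂] [BorelSpace E₂]
  (hg₁ : ∀ i t, ∀ᵐ ω ∂P, g₁ i t ω ∈ subdiff X₁ (fun y => f₁ i y (u₂ i t ω)) (v₁ i t ω))
  (hg₂ : ∀ j t, ∀ᵐ ω ∂P, g₂ j t ω ∈ subdiff X₂ (fun y => f₂ j y (u₁ j t ω)) (v₂ j t ω))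

include hg₁ hg₂

theorem IsNash.mul_integral_sq_dist_le [IsFiniteMeasure P]
    (hU : IsStronglyConvexConcave X₁ X₂ μ U) (hy : IsNash X₁ X₂ U y₁ y₂) (i : Fin n₁) (j : Fin n₂)
    (t : ℕ) :
    μ / 2 * ∫ ω, (‖x₁ i t ω - y₁‖ ^ 2 + ‖x₂ j t ω - y₂‖ ^ 2) ∂P
      ≤ ∫ ω, linearizedRegret g₁ v₁ y₁ t ω ∂P + ∫ ω, linearizedRegret g₂ v₂ y₂ t ω ∂P
        + 4 * L * (∫ ω, disagreement η B₁ x₁ v₁ t ω ∂P + ∫ ω, disagreement η B₂ x₂ v₂ t ω ∂P) := by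
  have hr₁ := h₁.integrable_linearizedRegret (fun i => h₁.integrable_gradient i t) y₁
  have hr₂ := h₂.integrable_linearizedRegret (fun j => h₂.integrable_gradient j t) y₂
  have hr : Integrable (fun ω => linearizedRegret g₁ v₁ y₁ t ω + linearizedRegret g₂ v₂ y₂ t ω) P :=
    hr₁.add hr₂
  have hd₁ := h₁.integrable_disagreement t
  have hd₂ := h₂.integrable_disagreement t
  have hd : Integrable (fun ω =>
      4 * L * (disagreement η B₁ x₁ v₁ t ω + disagreement η B₂ x₂ v₂ t ω)) P :=
    (hd₁.add hd₂).const_mul _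
  rw [← integral_const_mul, ← integral_add hr₁ hr₂, ← integral_add hd₁ hd₂, ← integral_const_mul,
    ← integral_add hr hd]
  refine integral_mono_ae (((h₁.integrable_norm_sub_pow i t 2 y₁).add
    (h₂.integrable_norm_sub_pow j t 2 y₂)).const_mul _) (hr.add hd) ?_
  filter_upwards [ae_all_iff.2 fun i => hg₁ i t, ae_all_iff.2 fun j => hg₂ j t] with ω hg₁ω hg₂ω
  exact hy.mul_sq_dist_le_linearizedRegret h₁ h₂ hf₁ hf₂ hU₁ hU₂ hu₂ hu₁ hU i j hg₁ω hg₂ω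

theorem IsNash.mul_sum_step_mul_integral_sq_dist_le [IsFiniteMeasure P]
    (hU : IsStronglyConvexConcave X₁ X₂ μ U) (hy : IsNash X₁ X₂ U y₁ y₂) (i : Fin n₁) (j : Fin n₂)
    (T : ℕ) :
    μ / 2 * ∑ t ∈ Finset.range T, α t * ∫ ω, (‖x₁ i t ω - y₁‖ ^ 2 + ‖x₂ j t ω - y₂‖ ^ 2) ∂P
      ≤ ∑ t ∈ Finset.range T, α t * ∫ ω, linearizedRegret g₁ v₁ y₁ t ω ∂P
        + 4 * L * ∑ t ∈ Finset.range T, α t * ∫ ω, disagreement η B₁ x₁ v₁ t ω ∂P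
        + (∑ t ∈ Finset.range T, α t * ∫ ω, linearizedRegret g₂ v₂ y₂ t ω ∂P
          + 4 * L * ∑ t ∈ Finset.range T, α t * ∫ ω, disagreement η B₂ x₂ v₂ t ω ∂P) := by
  simp only [Finset.mul_sum, ← Finset.sum_add_distrib]
  refine Finset.sum_le_sum fun t _ => ?_
  have hstep := mul_le_mul_of_nonneg_left
    (hy.mul_integral_sq_dist_le h₁ h₂ hf₁ hf₂ hU₁ hU₂ hu₂ hu₁ hg₁ hg₂ hU i j t) (h₁.step_nonneg t)
  linarith

theorem IsNash.integral_sqError_le [IsProbabilityMeasure P] (hμ : 0 < μ)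
    (hU : IsStronglyConvexConcave X₁ X₂ μ U) (hy : IsNash X₁ X₂ U y₁ y₂) (i : Fin n₁) (j : Fin n₂)
    {t : ℕ} (ht : 0 < ∑ s ∈ Finset.range t, α s) :
    ∫ ω, sqError α (x₁ i) (x₂ j) y₁ y₂ t ω ∂P ≤
      2 / μ * ((M1part L η n₁ B₁ (Lam P x₁) (α 0) R₁ + M1part L η n₂ B₂ (Lam P x₂) (α 0) R₂
        + (M2part L ν₁ η n₁ B₁ + M2part L ν₂ η n₂ B₂) * ∑ s ∈ Finset.range t, α s ^ 2)
        / ∑ s ∈ Finset.range t, α s) := by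
  refine (DSMD.integral_sqError_le h₁ h₂ i j ht y₁ y₂).trans ?_
  rw [inv_mul_eq_div, ← mul_div_assoc]
  refine div_le_div_of_nonneg_right ?_ ht.le
  rw [div_mul_eq_mul_div, le_div_iff₀' hμ]
  linarith [hy.mul_sum_step_mul_integral_sq_dist_le h₁ h₂ hf₁ hf₂ hU₁ hU₂ hu₂ hu₁ hg₁ hg₂ hU i j t,
    h₁.sum_step_mul_integral_regret_add_disagreement_le hy.1 t,
    h₂.sum_step_mul_integral_regret_add_disagreement_le hy.2.1 t]

end Regret

end TwoNetworks

/-! ### The sampling model -/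

section History

variable {Ω Z E₁ E₂ : Type*} [MeasurableSpace Z] [MeasurableSpace E₁] [MeasurableSpace E₂]
  {n₁ n₂ : ℕ} {x₁ : Fin n₁ → ℕ → Ω → E₁} {x₂ : Fin n₂ → ℕ → Ω → E₂}
  {ξ₁ : Fin n₁ → ℕ → Ω → Z} {ξ₂ : Fin n₂ → ℕ → Ω → Z}

theorem history_mono : Monotone (history x₁ x₂ ξ₁ ξ₂) := fun _ _ hst =>
  sup_le_sup le_rfl <| sup_le_sup
    (iSup_mono fun _ => iSup_mono fun _ => iSup_mono' fun hr => ⟨hr.trans_le hst, le_rfl⟩)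
    (iSup_mono fun _ => iSup_mono fun _ => iSup_mono' fun hr => ⟨hr.trans_le hst, le_rfl⟩)

theorem history_le {mΩ : MeasurableSpace Ω} (hx₁ : ∀ i, Measurable (x₁ i 0))
    (hx₂ : ∀ i, Measurable (x₂ i 0)) (hξ₁ : ∀ i t, Measurable (ξ₁ i t))
    (hξ₂ : ∀ i t, Measurable (ξ₂ i t)) (t : ℕ) : history x₁ x₂ ξ₁ ξ₂ t ≤ mΩ :=
  sup_le (sup_le (iSup_le fun i => (hx₁ i).comap_le) (iSup_le fun i => (hx₂ i).comap_le))
    (sup_le (iSup_le fun i => iSup_le fun s => iSup_le fun _ => (hξ₁ i s).comap_le)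
      (iSup_le fun i => iSup_le fun s => iSup_le fun _ => (hξ₂ i s).comap_le))

theorem measurable_history_left (i : Fin n₁) : Measurable[history x₁ x₂ ξ₁ ξ₂ 0] (x₁ i 0) :=
  Measurable.of_comap_le ((le_iSup (fun i => MeasurableSpace.comap (x₁ i 0) inferInstance) i).trans
    (le_sup_left.trans le_sup_left))

theorem measurable_history_right (i : Fin n₂) : Measurable[history x₁ x₂ ξ₁ ξ₂ 0] (x₂ i 0) :=
  Measurable.of_comap_le ((le_iSup (fun i => MeasurableSpace.comap (x₂ i 0) inferInstance) i).trans
    (le_sup_right.trans le_sup_left))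

/-- The filtration of the histories `ℱ_t`. -/
@[reducible] def historyFiltration {mΩ : MeasurableSpace Ω} (hx₁ : ∀ i, Measurable (x₁ i 0))
    (hx₂ : ∀ i, Measurable (x₂ i 0)) (hξ₁ : ∀ i t, Measurable (ξ₁ i t))
    (hξ₂ : ∀ i t, Measurable (ξ₂ i t)) : Filtration ℕ mΩ where
  seq := history x₁ x₂ ξ₁ ξ₂
  mono' := history_mono
  le' := history_le hx₁ hx₂ hξ₁ hξ₂

end History

section CrossMixing

variable {Ω E : Type*} [NormedAddCommGroup E] [NormedSpace ℝ E] {n₁ n₂ : ℕ}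
  {G : ℕ → Digraph (Fin n₁ ⊕ Fin n₂)} {W : ℕ → Matrix (Fin n₁ ⊕ Fin n₂) (Fin n₁ ⊕ Fin n₂) ℝ}

theorem IsCrossMixing.mem_convexHull_left (h : IsCrossMixing G W) {x : Fin n₂ → ℕ → Ω → E}
    {u : Fin n₁ → ℕ → Ω → E} (hu : u = fun i t => mix (fun j => W t (Sum.inl i) (Sum.inr j)) x t)
    (i : Fin n₁) (t : ℕ) (ω : Ω) : u i t ω ∈ convexHull ℝ (Set.range fun j => x j t ω) :=
  hu ▸ mix_mem_convexHull (fun _ => h.nonneg t _ _) (h.row_sum₁ t i) ω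

theorem IsCrossMixing.mem_convexHull_right (h : IsCrossMixing G W) {x : Fin n₁ → ℕ → Ω → E}
    {u : Fin n₂ → ℕ → Ω → E} (hu : u = fun i t => mix (fun j => W t (Sum.inr i) (Sum.inl j)) x t)
    (i : Fin n₂) (t : ℕ) (ω : Ω) : u i t ω ∈ convexHull ℝ (Set.range fun j => x j t ω) :=
  hu ▸ mix_mem_convexHull (fun _ => h.nonneg t _ _) (h.row_sum₂ t i) ω

end CrossMixing

section Run

variable {Ω Z E : Type*} {mΩ : MeasurableSpace Ω} {P : Measure Ω} [NormedAddCommGroup E]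
  [NormedSpace ℝ E] [MeasurableSpace E] {F : Type*} {n : ℕ}
  {X O : Set E} {Y : Set F} {ψ : E → ℝ} {R : ℝ} {α : ℕ → ℝ} {L ν η : ℝ} {B : ℕ}
  {φ : Fin n → E → F → Z → ℝ} {f : Fin n → E → F → ℝ} {ξ : Fin n → ℕ → Ω → Z}
  {G : ℕ → Digraph (Fin n)} {W : ℕ → Matrix (Fin n) (Fin n) ℝ} {ℱ : Filtration ℕ mΩ}
  {v : Fin n → ℕ → Ω → E} {u : Fin n → ℕ → Ω → F} {g ghat : Fin n → ℕ → Ω → StrongDual ℝ E}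
  {x : Fin n → ℕ → Ω → E}

theorem IsRun.mem {ℱ : ℕ → MeasurableSpace Ω} (h : IsRun X O ψ α φ ℱ ξ v u ghat x)
    (i : Fin n) (t : ℕ) (ω : Ω) : x i t ω ∈ X :=
  IsProx.mem_iterate (x := fun t => x i t ω) (h.init_mem i ω) (fun t => h.update i t ω) t

variable [NormedAddCommGroup F]

theorem IsRun.networkRun (h : IsRun X O ψ α φ ℱ ξ v u ghat x) (hn : 0 < n) (hη : 0 < η ∧ η < 1)
    (hL : 0 < L) (hν : 0 < ν) (hα₀ : ∀ t, 0 ≤ α t) (hα : Antitone α) (hX₀ : X.Nonempty)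
    (hX : IsCompact X) (hO : IsOpen O) (hXO : X ⊆ O) (hψ : IsRegularizer X ψ)
    (hR : IsBregmanDiam X ψ R) (hψ' : ∀ z ∈ X, ConvexOn ℝ X (fun y => bregman ψ z y))
    (hW : IsMixing G W η B) (hv : v = fun i t => mix (W t i) x t) (hu : ∀ i t ω, u i t ω ∈ Y)
    (hf : ∀ i, IsLipschitzCost O Y L (f i)) (hx₀ : ∀ i, Measurable[ℱ 0] (x i 0))
    (hs : UnbiasedSampling P O f ν ℱ v u g ghat) :
    NetworkRun P X ψ R α L ν η B G W ℱ v g ghat x where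
  n_pos := hn
  η_mem := hη
  L_pos := hL
  ν_pos := hν
  step_nonneg := hα₀
  step_antitone := hα
  nonempty := hX₀
  compact := hX
  regularizer := hψ
  diam := hR
  bregman_convex := hψ'
  mixing := hW
  v_eq := hv
  init_mem := h.init_mem
  init_measurable := hx₀
  sampled_measurable := h.sampled_measurable
  update := h.update
  norm_le i t := by
    filter_upwards [hs.subgradient i t] with ω hg
    exact (hf i).norm_le_of_mem_subdiff hO hL.le (hXO (mem_of_mem_convexHull_range
      hψ.strongConvex.1 (fun j => h.mem j t ω) (hW.mem_convexHull hη.1 hv i t ω))) (hu i t ω) hg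
  integrable := hs.integrable
  unbiased := hs.unbiased
  sq_integrable := hs.sq_integrable
  variance_le := hs.variance_le

end Run

end DSMD

theorem corollary2_general
    {Ω : Type*} {mΩ : MeasurableSpace Ω} {P : Measure Ω} [IsProbabilityMeasure P]
    {E₁ : Type*} [NormedAddCommGroup E₁] [NormedSpace ℝ E₁] [FiniteDimensional ℝ E₁]
    [MeasurableSpace E₁] [BorelSpace E₁]
    {E₂ : Type*} [NormedAddCommGroup E₂] [NormedSpace ℝ E₂] [FiniteDimensional ℝ E₂]
    [MeasurableSpace E₂] [BorelSpace E₂]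
    {X₁ : Set E₁} {X₂ : Set E₂} {ψ₁ : E₁ → ℝ} {ψ₂ : E₂ → ℝ} {R₁ R₂ : ℝ} {α : ℕ → ℝ}
    {n₁ n₂ : ℕ} {f₁ : Fin n₁ → E₁ → E₂ → ℝ} {f₂ : Fin n₂ → E₂ → E₁ → ℝ} {L ν₁ ν₂ η : ℝ}
    {B₁ B₂ : ℕ} {G₁ : ℕ → Digraph (Fin n₁)} {W₁ : ℕ → Matrix (Fin n₁) (Fin n₁) ℝ}
    {G₂ : ℕ → Digraph (Fin n₂)} {W₂ : ℕ → Matrix (Fin n₂) (Fin n₂) ℝ} {ℱ : Filtration ℕ mΩ}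
    {x₁ v₁ : Fin n₁ → ℕ → Ω → E₁} {u₂ : Fin n₁ → ℕ → Ω → E₂}
    {x₂ v₂ : Fin n₂ → ℕ → Ω → E₂} {u₁ : Fin n₂ → ℕ → Ω → E₁}
    {g₁ ghat₁ : Fin n₁ → ℕ → Ω → StrongDual ℝ E₁} {g₂ ghat₂ : Fin n₂ → ℕ → Ω → StrongDual ℝ E₂}
    {U : E₁ → E₂ → ℝ} {μ : ℝ}
    (h₁ : DSMD.NetworkRun P X₁ ψ₁ R₁ α L ν₁ η B₁ G₁ W₁ ℱ v₁ g₁ ghat₁ x₁)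
    (h₂ : DSMD.NetworkRun P X₂ ψ₂ R₂ α L ν₂ η B₂ G₂ W₂ ℱ v₂ g₂ ghat₂ x₂)
    (hf₁ : ∀ i, DSMD.IsLipschitzCost X₁ X₂ L (f₁ i))
    (hf₂ : ∀ j, DSMD.IsLipschitzCost X₂ X₁ L (f₂ j))
    (hU₁ : ∀ x₁ ∈ X₁, ∀ x₂ ∈ X₂, U x₁ x₂ = 1 / (n₁ : ℝ) * ∑ i, f₁ i x₁ x₂)
    (hU₂ : ∀ x₁ ∈ X₁, ∀ x₂ ∈ X₂, U x₁ x₂ = -(1 / (n₂ : ℝ) * ∑ j, f₂ j x₂ x₁))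
    (hu₂ : ∀ i t ω, u₂ i t ω ∈ convexHull ℝ (Set.range fun j => x₂ j t ω))
    (hu₁ : ∀ j t ω, u₁ j t ω ∈ convexHull ℝ (Set.range fun i => x₁ i t ω))
    (hg₁ : ∀ i t, ∀ᵐ ω ∂P, g₁ i t ω ∈ DSMD.subdiff X₁ (fun y => f₁ i y (u₂ i t ω)) (v₁ i t ω))
    (hg₂ : ∀ j t, ∀ᵐ ω ∂P, g₂ j t ω ∈ DSMD.subdiff X₂ (fun y => f₂ j y (u₁ j t ω)) (v₂ j t ω))
    (hμ : 0 < μ) (hU : DSMD.IsStronglyConvexConcave X₁ X₂ μ U) :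
    (∃! y : E₁ × E₂, DSMD.IsNash X₁ X₂ U y.1 y.2) ∧
    ∀ y₁ y₂, DSMD.IsNash X₁ X₂ U y₁ y₂ → ∀ (i : Fin n₁) (j : Fin n₂),
      (∀ t : ℕ, 0 < ∑ s ∈ Finset.range t, α s →
        Integrable (DSMD.sqError α (x₁ i) (x₂ j) y₁ y₂ t) P ∧
        ∫ ω, DSMD.sqError α (x₁ i) (x₂ j) y₁ y₂ t ω ∂P ≤
          2 / μ * ((DSMD.M1part L η n₁ B₁ (DSMD.Lam P x₁) (α 0) R₁
              + DSMD.M1part L η n₂ B₂ (DSMD.Lam P x₂) (α 0) R₂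
            + (DSMD.M2part L ν₁ η n₁ B₁ + DSMD.M2part L ν₂ η n₂ B₂)
              * ∑ s ∈ Finset.range t, α s ^ 2) / ∑ s ∈ Finset.range t, α s)) ∧
      (Tendsto (fun t => ∑ s ∈ Finset.range t, α s) atTop atTop → Summable (fun t => α t ^ 2) →
        Tendsto (fun t => ∫ ω, DSMD.sqError α (x₁ i) (x₂ j) y₁ y₂ t ω ∂P) atTop (𝓝 0)) := by
  have hULip := DSMD.IsLipschitzCost.of_eq_one_div_mul_sum h₁.n_pos hf₁ hU₁
  refine ⟨DSMD.existsUnique_isNash h₁.nonempty h₁.compact h₂.nonempty h₂.compact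
    (fun _ hy => (hULip.continuousOn_left hy).lowerSemicontinuousOn)
    (fun _ hx => (hULip.continuousOn_right hx).upperSemicontinuousOn) hμ hU,
    fun y₁ y₂ hy i j => ?_⟩
  have hbound := fun t ht => hy.integral_sqError_le h₁ h₂ hf₁ hf₂ hU₁ hU₂ hu₂ hu₁ hg₁ hg₂ hμ hU
    i j (t := t) ht
  refine ⟨fun t ht => ⟨DSMD.integrable_sqError h₁ h₂ i j ht y₁ y₂, hbound t ht⟩, fun hA hq => ?_⟩
  exact DSMD.tendsto_zero_of_le_mul_add_mul_div (div_pos two_pos hμ).le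
    (add_nonneg
      (DSMD.M2part_nonneg h₁.L_pos.le h₁.ν_pos.le h₁.η_mem h₁.n_pos h₁.mixing.one_le_window)
      (DSMD.M2part_nonneg h₂.L_pos.le h₂.ν_pos.le h₂.η_mem h₂.n_pos h₂.mixing.one_le_window))
    (fun t => integral_nonneg fun ω => DSMD.sqError_nonneg α _ _ y₁ y₂ t ω)
    (fun t => sq_nonneg (α t)) hq hA hbound

theorem corollary2
    {Ω : Type*} [MeasurableSpace Ω] (P : Measure Ω) [IsProbabilityMeasure P]
    -- the strategy spaces, with arbitrary norms
    {E₁ : Type*} [NormedAddCommGroup E₁] [NormedSpace ℝ E₁] [FiniteDimensional ℝ E₁]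
    [MeasurableSpace E₁] [BorelSpace E₁]
    {E₂ : Type*} [NormedAddCommGroup E₂] [NormedSpace ℝ E₂] [FiniteDimensional ℝ E₂]
    [MeasurableSpace E₂] [BorelSpace E₂]
    -- the strategy sets and open convex neighbourhoods on which the costs are defined
    (X₁ O₁ : Set E₁) (X₂ O₂ : Set E₂)
    (hX₁ : X₁.Nonempty ∧ IsCompact X₁ ∧ Convex ℝ X₁)
    (hX₂ : X₂.Nonempty ∧ IsCompact X₂ ∧ Convex ℝ X₂)
    (hO₁ : IsOpen O₁ ∧ Convex ℝ O₁ ∧ X₁ ⊆ O₁) (hO₂ : IsOpen O₂ ∧ Convex ℝ O₂ ∧ X₂ ⊆ O₂)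
    -- the networks
    {n₁ n₂ : ℕ} (hn₁ : 0 < n₁) (hn₂ : 0 < n₂) (η : ℝ) (hη : 0 < η ∧ η < 1) (B₁ B₂ : ℕ)
    (G₁ : ℕ → Digraph (Fin n₁)) (W₁ : ℕ → Matrix (Fin n₁) (Fin n₁) ℝ)
    (G₂ : ℕ → Digraph (Fin n₂)) (W₂ : ℕ → Matrix (Fin n₂) (Fin n₂) ℝ)
    (G₁₂ : ℕ → Digraph (Fin n₁ ⊕ Fin n₂))
    (W₁₂ : ℕ → Matrix (Fin n₁ ⊕ Fin n₂) (Fin n₁ ⊕ Fin n₂) ℝ)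
    (hW₁ : DSMD.IsMixing G₁ W₁ η B₁) (hW₂ : DSMD.IsMixing G₂ W₂ η B₂)
    (hW₁₂ : DSMD.IsCrossMixing G₁₂ W₁₂)
    -- the random vector and the sampled and expected costs of the agents
    {d : ℕ} (ξ : Ω → (Fin d → ℝ))
    (φ₁ : Fin n₁ → E₁ → E₂ → (Fin d → ℝ) → ℝ) (φ₂ : Fin n₂ → E₁ → E₂ → (Fin d → ℝ) → ℝ)
    (f₁ : Fin n₁ → E₁ → E₂ → ℝ) (f₂ : Fin n₂ → E₁ → E₂ → ℝ)
    (hf₁ : f₁ = fun i => DSMD.expCost P ξ (φ₁ i)) (hf₂ : f₂ = fun j => DSMD.expCost P ξ (φ₂ j))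
    (hφ₁ : ∀ i, ∀ x₁ ∈ O₁, ∀ x₂ ∈ X₂, Integrable (fun ω => φ₁ i x₁ x₂ (ξ ω)) P)
    (hφ₂ : ∀ j, ∀ x₁ ∈ X₁, ∀ x₂ ∈ O₂, Integrable (fun ω => φ₂ j x₁ x₂ (ξ ω)) P)
    (hcc₁ : ∀ i, DSMD.IsConvexConcave O₁ X₂ (f₁ i))
    (hcc₂ : ∀ j, DSMD.IsConvexConcave O₂ X₁ (fun x₂ x₁ => f₂ j x₁ x₂))
    -- the cost function of the game
    (U : E₁ → E₂ → ℝ)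
    (hU₁ : ∀ x₁ ∈ X₁, ∀ x₂ ∈ X₂, U x₁ x₂ = (1 / (n₁ : ℝ)) * ∑ i, f₁ i x₁ x₂)
    (hU₂ : ∀ x₁ ∈ X₁, ∀ x₂ ∈ X₂, U x₁ x₂ = -((1 / (n₂ : ℝ)) * ∑ j, f₂ j x₁ x₂))
    (μ : ℝ) (hμ : 0 < μ) (hU : DSMD.IsStronglyConvexConcave X₁ X₂ μ U)
    -- the regularizers
    (ψ₁ : E₁ → ℝ) (ψ₂ : E₂ → ℝ)
    (hψ₁ : DSMD.IsRegularizer X₁ ψ₁) (hψ₂ : DSMD.IsRegularizer X₂ ψ₂)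
    (R₁ R₂ : ℝ) (hR₁ : DSMD.IsBregmanDiam X₁ ψ₁ R₁) (hR₂ : DSMD.IsBregmanDiam X₂ ψ₂ R₂)
    -- the algorithm: step sizes, samples, averages over the neighbours, sampled subgradients
    (α : ℕ → ℝ) (hα₀ : ∀ t, 0 ≤ α t) (hα : Antitone α)
    (ξ₁ : Fin n₁ → ℕ → Ω → (Fin d → ℝ)) (ξ₂ : Fin n₂ → ℕ → Ω → (Fin d → ℝ))
    (hξ : DSMD.IsIIDSample P ξ ξ₁ ξ₂)
    (x₁ v₁ : Fin n₁ → ℕ → Ω → E₁) (u₂ : Fin n₁ → ℕ → Ω → E₂)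
    (x₂ v₂ : Fin n₂ → ℕ → Ω → E₂) (u₁ : Fin n₂ → ℕ → Ω → E₁)
    (hv₁ : v₁ = fun i t => DSMD.mix (W₁ t i) x₁ t)
    (hv₂ : v₂ = fun i t => DSMD.mix (W₂ t i) x₂ t)
    (hu₂ : u₂ = fun i t => DSMD.mix (fun j => W₁₂ t (Sum.inl i) (Sum.inr j)) x₂ t)
    (hu₁ : u₁ = fun i t => DSMD.mix (fun j => W₁₂ t (Sum.inr i) (Sum.inl j)) x₁ t)
    (g₁ ghat₁ : Fin n₁ → ℕ → Ω → StrongDual ℝ E₁) (g₂ ghat₂ : Fin n₂ → ℕ → Ω → StrongDual ℝ E₂)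
    (hrun₁ : DSMD.IsRun X₁ O₁ ψ₁ α φ₁ (DSMD.history x₁ x₂ ξ₁ ξ₂) ξ₁ v₁ u₂ ghat₁ x₁)
    (hrun₂ : DSMD.IsRun X₂ O₂ ψ₂ α (fun j x₂ x₁ z => φ₂ j x₁ x₂ z)
      (DSMD.history x₁ x₂ ξ₁ ξ₂) ξ₂ v₂ u₁ ghat₂ x₂)
    -- first assumption: Lipschitz costs
    (L : ℝ) (hL : 0 < L)
    (hA1₁ : ∀ i, DSMD.IsLipschitzCost O₁ X₂ L (f₁ i))
    (hA1₂ : ∀ j, DSMD.IsLipschitzCost O₂ X₁ L (fun x₂ x₁ => f₂ j x₁ x₂))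
    -- second assumption: unbiased sampled subgradients with bounded variance
    (ν₁ ν₂ : ℝ) (hν₁ : 0 < ν₁) (hν₂ : 0 < ν₂)
    (hA2₁ : DSMD.UnbiasedSampling P O₁ f₁ ν₁ (DSMD.history x₁ x₂ ξ₁ ξ₂) v₁ u₂ g₁ ghat₁)
    (hA2₂ : DSMD.UnbiasedSampling P O₂ (fun j x₂ x₁ => f₂ j x₁ x₂) ν₂
      (DSMD.history x₁ x₂ ξ₁ ξ₂) v₂ u₁ g₂ ghat₂)
    -- third assumption: Bregman divergences
    (hA3₁ : DSMD.BregmanAssumption X₁ ψ₁) (hA3₂ : DSMD.BregmanAssumption X₂ ψ₂)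
    -- the constants of the bound
    (M₁ M₂ : ℝ)
    (hM₁ : M₁ = DSMD.M1part L η n₁ B₁ (DSMD.Lam P x₁) (α 0) R₁
      + DSMD.M1part L η n₂ B₂ (DSMD.Lam P x₂) (α 0) R₂)
    (hM₂ : M₂ = DSMD.M2part L ν₁ η n₁ B₁ + DSMD.M2part L ν₂ η n₂ B₂) :
    (∃! y : E₁ × E₂, DSMD.IsNash X₁ X₂ U y.1 y.2) ∧
    ∀ y₁ y₂, DSMD.IsNash X₁ X₂ U y₁ y₂ → ∀ (i : Fin n₁) (j : Fin n₂),
      (∀ t : ℕ, 0 < ∑ s ∈ Finset.range t, α s →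
        Integrable (DSMD.sqError α (x₁ i) (x₂ j) y₁ y₂ t) P ∧
        ∫ ω, DSMD.sqError α (x₁ i) (x₂ j) y₁ y₂ t ω ∂P ≤
          2 / μ * ((M₁ + M₂ * ∑ s ∈ Finset.range t, α s ^ 2) / ∑ s ∈ Finset.range t, α s)) ∧
      (Tendsto (fun t => ∑ s ∈ Finset.range t, α s) atTop atTop → Summable (fun t => α t ^ 2) →
        Tendsto (fun t => ∫ ω, DSMD.sqError α (x₁ i) (x₂ j) y₁ y₂ t ω ∂P) atTop (𝓝 0)) := by
  subst hM₁ hM₂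
  let ℱ := DSMD.historyFiltration hrun₁.init_measurable hrun₂.init_measurable hξ.measurable₁
    hξ.measurable₂
  have hull₂ := hW₁₂.mem_convexHull_left hu₂
  have hull₁ := hW₁₂.mem_convexHull_right hu₁
  have h₁ := hrun₁.networkRun (ℱ := ℱ) hn₁ hη hL hν₁ hα₀ hα hX₁.1 hX₁.2.1 hO₁.1 hO₁.2.2 hψ₁ hR₁
    hA3₁.convex_right hW₁ hv₁ (fun i t ω => DSMD.mem_of_mem_convexHull_range hX₂.2.2
      (fun j => hrun₂.mem j t ω) (hull₂ i t ω)) hA1₁ DSMD.measurable_history_left hA2₁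
  have h₂ := hrun₂.networkRun (ℱ := ℱ) hn₂ hη hL hν₂ hα₀ hα hX₂.1 hX₂.2.1 hO₂.1 hO₂.2.2 hψ₂ hR₂
    hA3₂.convex_right hW₂ hv₂ (fun j t ω => DSMD.mem_of_mem_convexHull_range hX₁.2.2
      (fun i => hrun₁.mem i t ω) (hull₁ j t ω)) hA1₂ DSMD.measurable_history_right hA2₂
  exact corollary2_general h₁ h₂ (fun i => (hA1₁ i).mono_left hO₁.2.2)
    (fun j => (hA1₂ j).mono_left hO₂.2.2) hU₁ hU₂ hull₂ hull₁
    (fun i t => (hA2₁.subgradient i t).mono fun _ hg => DSMD.subdiff_anti hO₁.2.2 _ _ hg)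
    (fun j t => (hA2₂.subgradient j t).mono fun _ hg => DSMD.subdiff_anti hO₂.2.2 _ _ hg) hμ hU
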